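/- Let $\Gamma$ be a finite simple connected regular graph with vertex set $V$, $n=|V|\ge 2$, and adjacency matrix $A$. Let $\lambda_0>\lambda_1>\cdots>\lambda_d$ be the distinct eigenvalues of $A$, let $m_j$ be the multiplicity of $\lambda_j$, and let $E_j$ be the matrix of the orthogonal projection of $\mathbb{R}^V$ onto the eigenspace of $\lambda_j$. Assume that the diameter $D$ of $\Gamma$ equals $d$. For $0\le i,j\le d$ put $$\overline m_j=\frac{m_j}{n},\qquad \overline\delta_i=\frac1n\,\bigl|\{(u,v)\in V^2:\operatorname{dist}(u,v)=i\}\bigr|,\qquad \overline m_{ij}=\frac{1}{n\overline\delta_i}\sum_{\operatorname{dist}(u,v)=i}(E_j)_{uv},$$ where the last sum is over ordered pairs $(u,v)$. Let $p_0,\dots,p_d$ be the predistance polynomials of $\Gamma$, that is, the polynomials with $\deg p_i=i$ that are orthogonal for the scalar product $\langle f,g\rangle=\frac1n\operatorname{tr}(f(A)g(A))$ on the real polynomials of degree at most $d$ and satisfy $\langle p_i,p_i\rangle=p_i(\lambda_0)$; put $s_i=p_0+\cdots+p_i$. For $u\in V$ let $N_i(u)$ be the set of vertices at distance at most $i$ from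 $u$. Then $\Gamma$ is distance-regular if and only if any one of the following conditions holds (so each of them separately is equivalent to distance-regularity): (a) $\displaystyle \frac1{\overline\delta_d}=\sum_{j=0}^d\frac{\overline m_{dj}^2}{\overline m_j}$; (b) $\displaystyle \overline m_j=\sum_{i=0}^{D}\overline\delta_i\,\overline m_{ij}^2$ for both $j=1$ and $j=d$; (c) $\displaystyle s_{d-1}(\lambda_0)=\frac{n}{\sum_{u\in V}|N_{d-1}(u)|^{-1}}$. -/

import Mathlib

namespace SimpleGraph

/-- A graph is distance-regular if it is connected and there are numbers `b i`, `c i` such that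
for any two vertices `u`, `v` at distance `i`, exactly `b i` neighbours of `v` are at distance
`i + 1` from `u`, and exactly `c i` neighbours of `v` are at distance `i - 1` from `u`. -/
def IsDistanceRegular {V : Type*} [Fintype V] (G : SimpleGraph V) [DecidableRel G.Adj] : Prop :=
  G.Connected ∧ ∃ b c : ℕ → ℕ, ∀ u v : V,
    ((G.neighborFinset v).filter (fun w => G.dist u w = G.dist u v + 1)).card = b (G.dist u v) ∧
    ((G.neighborFinset v).filter (fun w => G.dist u w + 1 = G.dist u v)).card = c (G.dist u v)

/-- The average number of vertices at distance `i` from a vertex, that is, the average degree of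
the distance-`i` graph. -/
noncomputable def avgDistDegree {V : Type*} [Fintype V] (G : SimpleGraph V) (i : ℕ) : ℝ :=
  (∑ u : V, ((Finset.univ.filter (fun v : V => G.dist u v = i)).card : ℝ)) / Fintype.card V

/-- The number of vertices at distance at most `i` from `u`. -/
noncomputable def nbhdCard {V : Type*} [Fintype V] (G : SimpleGraph V) (i : ℕ) (u : V) : ℕ :=
  (Finset.univ.filter (fun v : V => G.dist u v ≤ i)).card

/-- The adjacency matrix as an operator on the Euclidean space with coordinates indexed by the
vertices. -/
noncomputable def adjOp {V : Type*} [Fintype V] [DecidableEq V] (G : SimpleGraph V)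
    [DecidableRel G.Adj] : Module.End ℝ (EuclideanSpace ℝ V) :=
  Matrix.toEuclideanLin (G.adjMatrix ℝ)

/-- The finite set of distinct eigenvalues of the adjacency matrix. -/
noncomputable def distinctEigenvalues {V : Type*} [Fintype V] [DecidableEq V] (G : SimpleGraph V)
    [DecidableRel G.Adj] : Finset ℝ :=
  (Module.End.finite_hasEigenvalue G.adjOp).toFinset

/-- The number `d` of distinct eigenvalues, minus one. -/
noncomputable def spectralDiam {V : Type*} [Fintype V] [DecidableEq V] (G : SimpleGraph V)
    [DecidableRel G.Adj] : ℕ :=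
  G.distinctEigenvalues.card - 1

/-- The distinct eigenvalues `λ₀ > λ₁ > ⋯ > λ_d` in decreasing order (the value is `0` for an index
greater than `d`). -/
noncomputable def eigenval {V : Type*} [Fintype V] [DecidableEq V] (G : SimpleGraph V)
    [DecidableRel G.Adj] (j : ℕ) : ℝ :=
  if h : j < G.distinctEigenvalues.card then
    G.distinctEigenvalues.orderEmbOfFin rfl (Fin.rev ⟨j, h⟩)
  else 0

/-- The average multiplicity `m_j / n` of the eigenvalue `λ_j`. -/
noncomputable def avgMult {V : Type*} [Fintype V] [DecidableEq V] (G : SimpleGraph V)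
    [DecidableRel G.Adj] (j : ℕ) : ℝ :=
  (Module.finrank ℝ (Module.End.eigenspace G.adjOp (G.eigenval j)) : ℝ) / Fintype.card V

/-- The principal idempotent `E_j`: the matrix of the orthogonal projection onto the eigenspace
of `λ_j`. -/
noncomputable def idempotent {V : Type*} [Fintype V] [DecidableEq V] (G : SimpleGraph V)
    [DecidableRel G.Adj] (j : ℕ) : Matrix V V ℝ :=
  (Matrix.toEuclideanCLM (n := V) (𝕜 := ℝ)).symm
    (Module.End.eigenspace G.adjOp (G.eigenval j)).starProjection

/-- The average crossed local multiplicity: the mean of the entries `(E_j)_{uv}` over the ordered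
pairs of vertices `u`, `v` at distance `i`. -/
noncomputable def avgCrossedMult {V : Type*} [Fintype V] [DecidableEq V] (G : SimpleGraph V)
    [DecidableRel G.Adj] (i j : ℕ) : ℝ :=
  (1 / (Fintype.card V * G.avgDistDegree i)) *
    ∑ u : V, ∑ v ∈ Finset.univ.filter (fun v : V => G.dist u v = i), G.idempotent j u v

/-- The scalar product `⟨f, g⟩ = (1/n) tr (f(A) g(A))` on real polynomials. -/
noncomputable def polyInner {V : Type*} [Fintype V] [DecidableEq V] (G : SimpleGraph V)
    [DecidableRel G.Adj] (f g : Polynomial ℝ) : ℝ :=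
  (Polynomial.aeval (G.adjMatrix ℝ) f * Polynomial.aeval (G.adjMatrix ℝ) g).trace / Fintype.card V

/-- The monic orthogonal polynomials of the scalar product `polyInner`, obtained from
`1, X, X ^ 2, …` by the Gram-Schmidt process. -/
noncomputable def monicOrthPoly {V : Type*} [Fintype V] [DecidableEq V] (G : SimpleGraph V)
    [DecidableRel G.Adj] (i : ℕ) : Polynomial ℝ :=
  Polynomial.X ^ i - ∑ j : Fin i,
    Polynomial.C (G.polyInner (Polynomial.X ^ i) (G.monicOrthPoly j) /
      G.polyInner (G.monicOrthPoly j) (G.monicOrthPoly j)) * G.monicOrthPoly j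
termination_by i
decreasing_by all_goals exact j.isLt

/-- The predistance polynomial `p_i` (`0 ≤ i ≤ d`): the multiple of the monic orthogonal polynomial
of degree `i` that is normalized by `⟨p_i, p_i⟩ = p_i(λ₀)`. -/
noncomputable def predistPoly {V : Type*} [Fintype V] [DecidableEq V] (G : SimpleGraph V)
    [DecidableRel G.Adj] (i : ℕ) : Polynomial ℝ :=
  Polynomial.C ((G.monicOrthPoly i).eval (G.eigenval 0) /
    G.polyInner (G.monicOrthPoly i) (G.monicOrthPoly i)) * G.monicOrthPoly i

/-- The sum `s_i = p_0 + p_1 + ⋯ + p_i` of predistance polynomials. -/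
noncomputable def predistSum {V : Type*} [Fintype V] [DecidableEq V] (G : SimpleGraph V)
    [DecidableRel G.Adj] (i : ℕ) : Polynomial ℝ :=
  ∑ j ∈ Finset.range (i + 1), G.predistPoly j

end SimpleGraph

/-! ### Orthogonal projections for the entrywise scalar product of matrices. -/

namespace SimpleGraph

section

set_option linter.unusedSectionVars false

open Finset Polynomial

variable {V : Type*} [Fintype V] [DecidableEq V]

/-! Write `A_i` for the distance matrices and `ℝ[A]` for the adjacency algebra. Under the entrywise
scalar product the nonzero `A_i` are orthogonal, and so are the `E_j`, which span `ℝ[A]`. The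
averages in the statement are normalized scalar products, so (a) and (b) are equality cases of
Bessel's inequality (`sum_sq_div_eq_iff`): (a) says that `A_d` lies in `ℝ[A]`, and (b) that `E_1`
and `E_d` are radial, that is, lie in the span of the `A_i`.

For (a), the point is that `A_D ∈ ℝ[A]` already forces distance-regularity
(`Connected.distMatrix_mem_adjoin`). As `D = d`, every element of `ℝ[A]` is a polynomial in `A` of
degree at most `D`, and the degree is the largest distance that it sees. A downward induction then
recovers each `A_i` from `A_{i+1} A` and the all-ones matrix.

For (b), the rows of a radial `E_j` are eigenvectors that depend on the distance only. At each
distance, `E_1` and `E_d` give two linear equations for the numbers `b` and `c`. The first family is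
monotone (`IsRadialEigen.mul_sub_nonneg`) and the second alternates in sign
(`IsRadialEigen.mul_succ_neg`), so the system is nonsingular and determines `b` and `c`.

For (c), `s_{d-1}` represents evaluation at `λ_0`, so `s_{d-1}(A)` has squared norm `n s_{d-1}(λ_0)`
and all row sums equal to `s_{d-1}(λ_0)`, and its support lies within distance `d - 1`.
Cauchy-Schwarz in each row bounds `s_{d-1}(λ_0)` by the harmonic mean of the ball sizes. Equality
makes the matrix a multiple of `J - A_d`, where `J` is the all-ones matrix, which reduces (c) to the
criterion behind (a). -/

/-- The entrywise scalar product of real square matrices. -/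
def frob : LinearMap.BilinForm ℝ (Matrix V V ℝ) :=
  LinearMap.mk₂ ℝ (fun M N => ∑ u, ∑ v, M u v * N u v)
    (by intros; simp [add_mul, sum_add_distrib])
    (by intros; simp [mul_sum, mul_assoc])
    (by intros; simp [mul_add, sum_add_distrib])
    (by intros; simp [mul_sum, mul_left_comm])

theorem frob_apply (M N : Matrix V V ℝ) : frob M N = ∑ u, ∑ v, M u v * N u v := rfl

theorem frob_comm (M N : Matrix V V ℝ) : frob M N = frob N M := by
  simp only [frob_apply, mul_comm]

theorem frob_eq_trace (M N : Matrix V V ℝ) : frob M N = (M * N.transpose).trace := by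
  simp [frob_apply, Matrix.trace, Matrix.mul_apply]

theorem frob_self_eq_zero {M : Matrix V V ℝ} : frob M M = 0 ↔ M = 0 := by
  refine ⟨fun h => ?_, fun h => by simp [h]⟩
  rw [frob_apply] at h
  have h1 := (sum_eq_zero_iff_of_nonneg
    fun u _ => sum_nonneg fun v _ => mul_self_nonneg (M u v)).1 h
  ext u v
  have := (sum_eq_zero_iff_of_nonneg fun v _ => mul_self_nonneg (M u v)).1 (h1 u (mem_univ u)) v
    (mem_univ v)
  simpa using this

/-- The orthogonal projection of `M` onto the span of an orthogonal family. -/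
noncomputable def frobProj (s : Finset ℕ) (F : ℕ → Matrix V V ℝ) (M : Matrix V V ℝ) :
    Matrix V V ℝ :=
  ∑ j ∈ s, (frob M (F j) / frob (F j) (F j)) • F j

theorem frob_frobProj {s : Finset ℕ} {F : ℕ → Matrix V V ℝ}
    (horth : ∀ i ∈ s, ∀ j ∈ s, i ≠ j → frob (F i) (F j) = 0)
    (hne : ∀ i ∈ s, frob (F i) (F i) ≠ 0) (M : Matrix V V ℝ) {i : ℕ} (hi : i ∈ s) :
    frob (frobProj s F M) (F i) = frob M (F i) := by
  rw [frobProj, map_sum, LinearMap.sum_apply, sum_eq_single_of_mem i hi]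
  · simp [hne i hi]
  · intro j hj hji
    simp [horth j hj i hi hji]

/-- Equality case of Bessel's inequality: the right-hand sum is the squared norm of the projection,
and by Pythagoras the defect is the squared norm of the residual. -/
theorem sum_sq_div_eq_iff {s : Finset ℕ} {F : ℕ → Matrix V V ℝ}
    (horth : ∀ i ∈ s, ∀ j ∈ s, i ≠ j → frob (F i) (F j) = 0)
    (hne : ∀ i ∈ s, frob (F i) (F i) ≠ 0) (M : Matrix V V ℝ) :
    frob M M = ∑ j ∈ s, frob M (F j) ^ 2 / frob (F j) (F j) ↔ M = frobProj s F M := by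
  set P := frobProj s F M with hP
  have h1 : ∀ N, frob N P = ∑ j ∈ s, frob M (F j) / frob (F j) (F j) * frob N (F j) := by
    intro N
    simp [hP, frobProj, map_sum]
  have h2 : frob M P = ∑ j ∈ s, frob M (F j) ^ 2 / frob (F j) (F j) := by
    rw [h1]
    exact sum_congr rfl fun j _ => by ring
  have h3 : frob P P = frob M P := by
    rw [h1, h1]
    exact sum_congr rfl fun j hj => by rw [frob_frobProj horth hne M hj]
  have h4 : frob (M - P) (M - P) = frob M M - frob M P := by
    simp only [map_sub, LinearMap.sub_apply, frob_comm P M, h3]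
    ring
  rw [← h2, ← sub_eq_zero (b := frob M P), ← h4, frob_self_eq_zero, sub_eq_zero]

theorem eq_frobProj_of_eq_sum {s : Finset ℕ} {F : ℕ → Matrix V V ℝ}
    (horth : ∀ i ∈ s, ∀ j ∈ s, i ≠ j → frob (F i) (F j) = 0)
    (hne : ∀ i ∈ s, frob (F i) (F i) ≠ 0) {M : Matrix V V ℝ} {c : ℕ → ℝ}
    (h : M = ∑ i ∈ s, c i • F i) : M = frobProj s F M := by
  rw [frobProj]
  conv_lhs => rw [h]
  refine sum_congr rfl fun i hi => ?_
  congr 1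
  rw [eq_div_iff (hne i hi), h, map_sum, LinearMap.sum_apply, sum_eq_single_of_mem i hi]
  · simp
  · intro j hj hji
    simp [horth j hj i hi hji]

/-! ### Distance matrices and radial matrices. -/

variable (G : SimpleGraph V)

/-- The adjacency matrix of the distance-`i` graph (the identity matrix for `i = 0` in a connected
graph). -/
noncomputable def distMatrix (i : ℕ) : Matrix V V ℝ :=
  Matrix.of fun u v => if G.dist u v = i then 1 else 0

/-- A matrix whose entries depend only on the distance between the two vertices. -/
def IsRadial (M : Matrix V V ℝ) : Prop := ∃ w : ℕ → ℝ, ∀ u v, M u v = w (G.dist u v)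

variable {G}

theorem distMatrix_apply (i : ℕ) (u v : V) :
    G.distMatrix i u v = if G.dist u v = i then 1 else 0 := rfl

theorem frob_distMatrix_right (M : Matrix V V ℝ) (i : ℕ) :
    frob M (G.distMatrix i) = ∑ u, ∑ v ∈ univ.filter (fun v => G.dist u v = i), M u v := by
  simp [frob_apply, distMatrix_apply, sum_filter]

theorem frob_distMatrix_of_ne {i j : ℕ} (h : i ≠ j) :
    frob (G.distMatrix i) (G.distMatrix j) = 0 := by
  rw [frob_apply]
  refine sum_eq_zero fun u _ => sum_eq_zero fun v _ => ?_
  simp only [distMatrix_apply]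
  split_ifs <;> simp_all

theorem Connected.dist_le_diam' (hG : G.Connected) (u v : V) : G.dist u v ≤ G.diam := by
  have := hG.nonempty
  exact dist_le_diam (connected_iff_ediam_ne_top.1 hG)

theorem Connected.dist_le_succ_of_adj (hG : G.Connected) (u : V) {v w : V} (h : G.Adj v w) :
    G.dist u w ≤ G.dist u v + 1 := by
  have := hG.dist_triangle (u := u) (v := v) (w := w)
  rwa [dist_eq_one_iff_adj.2 h] at this

theorem Connected.exists_adj_dist (hG : G.Connected) {u x : V} {i : ℕ} (h : G.dist u x = i + 1) :
    ∃ y, G.Adj x y ∧ G.dist u y = i := by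
  obtain ⟨p, hp⟩ := hG.exists_walk_length_eq_dist x u
  cases p with
  | nil => simp at h
  | cons hxy q =>
    rename_i y
    refine ⟨y, hxy, ?_⟩
    have h1 := hG.dist_le_succ_of_adj u hxy.symm
    have h2 := dist_le q
    rw [Walk.length_cons, dist_comm, h] at hp
    rw [dist_comm] at h2
    omega

theorem Connected.exists_dist_eq (hG : G.Connected) {u v : V} {i : ℕ} (hi : i ≤ G.dist u v) :
    ∃ x, G.dist u x = i := by
  induction hn : G.dist u v - i generalizing v with
  | zero => exact ⟨v, by omega⟩
  | succ n ih =>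
    obtain ⟨y, -, hy⟩ := hG.exists_adj_dist (u := u) (x := v) (i := G.dist u v - 1) (by omega)
    exact ih (v := y) (by omega) (by omega)

theorem Connected.exists_dist_eq_of_le_diam (hG : G.Connected) {i : ℕ} (hi : i ≤ G.diam) :
    ∃ u v, G.dist u v = i := by
  have := hG.nonempty
  obtain ⟨u, v, h⟩ := G.exists_dist_eq_diam
  obtain ⟨x, hx⟩ := hG.exists_dist_eq (u := u) (v := v) (i := i) (by omega)
  exact ⟨u, x, hx⟩

theorem Connected.frob_distMatrix_self_pos (hG : G.Connected) {i : ℕ} (hi : i ≤ G.diam) :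
    0 < frob (G.distMatrix i) (G.distMatrix i) := by
  refine lt_of_le_of_ne ?_ fun h => ?_
  · exact sum_nonneg fun u _ => sum_nonneg fun v _ => mul_self_nonneg _
  · obtain ⟨u, v, huv⟩ := hG.exists_dist_eq_of_le_diam hi
    have := congr_fun₂ (frob_self_eq_zero.1 h.symm) u v
    simp [distMatrix_apply, huv] at this

theorem distMatrix_eq_zero (hG : G.Connected) {i : ℕ} (hi : G.diam < i) :
    G.distMatrix i = 0 := by
  ext u v
  have := hG.dist_le_diam' u v
  simp [distMatrix_apply, show G.dist u v ≠ i by omega]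

theorem isRadial_frobProj (s : Finset ℕ) (M : Matrix V V ℝ) :
    G.IsRadial (frobProj s G.distMatrix M) := by
  refine ⟨fun i => if i ∈ s then
    frob M (G.distMatrix i) / frob (G.distMatrix i) (G.distMatrix i) else 0, fun u v => ?_⟩
  simp [frobProj, Matrix.sum_apply, distMatrix_apply]

theorem frobProj_apply_of_notMem (s : Finset ℕ) (M : Matrix V V ℝ) {u v : V}
    (h : G.dist u v ∉ s) : frobProj s G.distMatrix M u v = 0 := by
  simp [frobProj, Matrix.sum_apply, distMatrix_apply, h]

theorem IsRadial.eq_sum (hG : G.Connected) {M : Matrix V V ℝ} {w : ℕ → ℝ}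
    (h : ∀ u v, M u v = w (G.dist u v)) :
    M = ∑ i ∈ range (G.diam + 1), w i • G.distMatrix i := by
  ext u v
  have := hG.dist_le_diam' u v
  simp [Matrix.sum_apply, distMatrix_apply, h, Nat.lt_succ_of_le this]

theorem isRadial_iff_eq_frobProj (hG : G.Connected) (M : Matrix V V ℝ) :
    G.IsRadial M ↔ M = frobProj (range (G.diam + 1)) G.distMatrix M := by
  refine ⟨fun ⟨w, h⟩ => ?_, fun h => h ▸ isRadial_frobProj _ _⟩
  exact eq_frobProj_of_eq_sum (fun a _ b _ => frob_distMatrix_of_ne)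
    (fun a ha => (hG.frob_distMatrix_self_pos (by grind)).ne') (IsRadial.eq_sum hG h)

/-! ### Distance matrices inside the adjacency algebra. -/

variable [DecidableRel G.Adj]

theorem Connected.adjMatrix_pow_apply_eq_zero {u v : V} {i : ℕ} (hi : i < G.dist u v) :
    (G.adjMatrix ℝ ^ i) u v = 0 := by
  rw [adjMatrix_pow_apply_eq_card_walk, Nat.cast_eq_zero, Fintype.card_eq_zero_iff]
  exact ⟨fun p => by have := dist_le p.1; have := p.2; grind⟩

theorem Connected.adjMatrix_pow_dist_pos (hG : G.Connected) (u v : V) :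
    0 < (G.adjMatrix ℝ ^ G.dist u v) u v := by
  rw [adjMatrix_pow_apply_eq_card_walk, Nat.cast_pos, Fintype.card_pos_iff]
  obtain ⟨p, hp⟩ := hG.exists_walk_length_eq_dist u v
  exact ⟨⟨p, hp⟩⟩

theorem aeval_adjMatrix_apply {f : ℝ[X]} {u v : V} (h : f.natDegree ≤ G.dist u v) :
    aeval (G.adjMatrix ℝ) f u v =
      f.coeff (G.dist u v) * (G.adjMatrix ℝ ^ G.dist u v) u v := by
  rw [aeval_eq_sum_range' (Nat.lt_succ_of_le h), Matrix.sum_apply,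
    sum_eq_single_of_mem (G.dist u v) (by simp)]
  · simp
  · intro i hi hne
    simp [Connected.adjMatrix_pow_apply_eq_zero (show i < G.dist u v by grind)]

/-- Links degree to distance. If the degree `m` were at least `i`, then on pairs at distance `m`
only the leading term would contribute, and it counts walks, so the product with `A_m` would be the
leading coefficient times a positive number. -/
theorem Connected.degree_lt_of_frob_eq_zero (hG : G.Connected) {f : ℝ[X]}
    (hf : f.natDegree ≤ G.diam) {i : ℕ}
    (h : ∀ l, i ≤ l → l ≤ G.diam → frob (aeval (G.adjMatrix ℝ) f) (G.distMatrix l) = 0) :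
    f.degree < i := by
  by_contra! hc
  have hf0 : f ≠ 0 := by
    rintro rfl
    simp at hc
  have hi : i ≤ f.natDegree := le_natDegree_of_coe_le_degree hc
  have h0 := h _ hi hf
  rw [frob_distMatrix_right] at h0
  have h1 : ∑ u, ∑ v ∈ univ.filter (fun v => G.dist u v = f.natDegree),
      aeval (G.adjMatrix ℝ) f u v = f.leadingCoeff *
      ∑ u, ∑ v ∈ univ.filter (fun v => G.dist u v = f.natDegree),
        (G.adjMatrix ℝ ^ G.dist u v) u v := by
    rw [mul_sum]
    refine sum_congr rfl fun u _ => ?_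
    rw [mul_sum]
    refine sum_congr rfl fun v hv => ?_
    have hv : G.dist u v = f.natDegree := by simpa using hv
    rw [aeval_adjMatrix_apply hv.ge, hv, leadingCoeff]
  rw [h1, mul_eq_zero, leadingCoeff_eq_zero] at h0
  have h2 := h0.resolve_left hf0
  rw [sum_eq_zero_iff_of_nonneg
    fun u _ => sum_nonneg fun v _ => (hG.adjMatrix_pow_dist_pos u v).le] at h2
  obtain ⟨u, v, huv⟩ := hG.exists_dist_eq_of_le_diam hf
  have h3 := (sum_eq_zero_iff_of_nonneg
    fun v _ => (hG.adjMatrix_pow_dist_pos u v).le).1 (h2 u (mem_univ u)) v (by simp [huv])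
  exact (hG.adjMatrix_pow_dist_pos u v).ne' h3

theorem distMatrix_mul_adjMatrix_apply (i : ℕ) (u v : V) :
    (G.distMatrix i * G.adjMatrix ℝ) u v =
      ((G.neighborFinset v).filter (fun w => G.dist u w = i)).card := by
  rw [mul_adjMatrix_apply]
  simp [distMatrix_apply]

/-- If the last distance matrix and the all-ones matrix are polynomials in the adjacency matrix,
and polynomials of degree at most the diameter suffice, then all distance matrices are polynomials
in the adjacency matrix. -/
theorem Connected.distMatrix_mem_adjoin (hG : G.Connected)
    (hdeg : ∀ M ∈ Algebra.adjoin ℝ {G.adjMatrix ℝ},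
      ∃ f : ℝ[X], f.natDegree ≤ G.diam ∧ aeval (G.adjMatrix ℝ) f = M)
    (hJ : Matrix.of (fun _ _ => 1) ∈ Algebra.adjoin ℝ {G.adjMatrix ℝ})
    (h : G.distMatrix G.diam ∈ Algebra.adjoin ℝ {G.adjMatrix ℝ}) (i : ℕ) :
    G.distMatrix i ∈ Algebra.adjoin ℝ {G.adjMatrix ℝ} := by
  rcases lt_or_ge G.diam i with hi | hi
  · rw [distMatrix_eq_zero hG hi]
    exact zero_mem _
  obtain ⟨n, hn⟩ : ∃ n, n + i = G.diam := ⟨G.diam - i, by omega⟩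
  induction n using Nat.strong_induction_on generalizing i with
  | _ n ih =>
    rcases Nat.eq_zero_or_pos n with rfl | hpos
    · rw [show i = G.diam by omega]
      exact h
    have hmem : ∀ l ∈ Icc (i + 1) G.diam,
        G.distMatrix l ∈ Algebra.adjoin ℝ {G.adjMatrix ℝ} := fun l hl => by
      rw [mem_Icc] at hl
      exact ih (G.diam - l) (by omega) l (by omega) (by omega)
    have horth : ∀ a ∈ Icc (i + 1) G.diam, ∀ b ∈ Icc (i + 1) G.diam, a ≠ b →
        frob (G.distMatrix a) (G.distMatrix b) = 0 := fun a _ b _ => frob_distMatrix_of_ne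
    have hne : ∀ a ∈ Icc (i + 1) G.diam, frob (G.distMatrix a) (G.distMatrix a) ≠ 0 :=
      fun a ha => (hG.frob_distMatrix_self_pos (mem_Icc.1 ha).2).ne'
    -- Removing the components along `A_l` for `l > i` leaves a polynomial in `A` of degree at most
    -- `i`. It vanishes beyond distance `i` and equals a multiple of `A ^ i` at distance exactly
    -- `i`.
    have key : ∀ M ∈ Algebra.adjoin ℝ {G.adjMatrix ℝ},
        M - frobProj (Icc (i + 1) G.diam) G.distMatrix M ∈ Algebra.adjoin ℝ {G.adjMatrix ℝ} ∧
        ∃ c : ℝ, ∀ u v, i ≤ G.dist u v →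
          (M - frobProj (Icc (i + 1) G.diam) G.distMatrix M) u v =
            if G.dist u v = i then c * (G.adjMatrix ℝ ^ i) u v else 0 := by
      intro M hM
      have hM' : M - frobProj (Icc (i + 1) G.diam) G.distMatrix M ∈
          Algebra.adjoin ℝ {G.adjMatrix ℝ} :=
        sub_mem hM (sum_mem fun l hl => Subalgebra.smul_mem _ (hmem l hl) _)
      obtain ⟨f, hf, hfM⟩ := hdeg _ hM'
      refine ⟨hM', f.coeff i, fun u v huv => ?_⟩
      have hlt : f.degree < (i + 1 : ℕ) := by
        refine hG.degree_lt_of_frob_eq_zero hf fun l h1 h2 => ?_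
        rw [hfM, map_sub, LinearMap.sub_apply, frob_frobProj horth hne _ (mem_Icc.2 ⟨h1, h2⟩),
          sub_self]
      have hle : f.natDegree ≤ i := natDegree_le_iff_coeff_eq_zero.2 fun m hm =>
        (degree_lt_iff_coeff_zero _ _).1 hlt m hm
      rw [← hfM, aeval_adjMatrix_apply (hle.trans huv)]
      split_ifs with h
      · rw [h]
      · rw [coeff_eq_zero_of_natDegree_lt (by omega), zero_mul]
    obtain ⟨hM', c, hc⟩ := key (G.distMatrix (i + 1) * G.adjMatrix ℝ)
      (mul_mem (hmem _ (by simp; omega)) (Algebra.self_mem_adjoin_singleton ℝ _))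
    obtain ⟨-, c', hc'⟩ := key _ hJ
    set M' := G.distMatrix (i + 1) * G.adjMatrix ℝ - frobProj (Icc (i + 1) G.diam) G.distMatrix
      (G.distMatrix (i + 1) * G.adjMatrix ℝ) with hMdef
    -- For the all-ones matrix, the remainder shows that all pairs at distance `i` are joined by the
    -- same number of walks of length `i`.
    have hone : ∀ u v, G.dist u v = i → c' * (G.adjMatrix ℝ ^ i) u v = 1 := by
      intro u v huv
      have := hc' u v huv.ge
      rw [if_pos huv, Matrix.sub_apply, frobProj_apply_of_notMem _ _ (by simp; omega)] at this
      rw [← this]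
      simp
    have hMc : ∀ u v, G.dist u v = i → M' u v =
        ((G.neighborFinset v).filter (fun w => G.dist u w = i + 1)).card := by
      intro u v huv
      rw [hMdef, Matrix.sub_apply, frobProj_apply_of_notMem _ _ (by simp; omega), sub_zero,
        distMatrix_mul_adjMatrix_apply]
    obtain ⟨u₀, x₀, hx₀⟩ := hG.exists_dist_eq_of_le_diam (show i + 1 ≤ G.diam by omega)
    obtain ⟨v₀, hv₀, hdv₀⟩ := hG.exists_adj_dist hx₀
    have hpos0 : 0 < M' u₀ v₀ := by
      rw [hMc _ _ hdv₀, Nat.cast_pos, card_pos]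
      exact ⟨x₀, by simp [hx₀, hv₀.symm]⟩
    have hc0 : c ≠ 0 := by
      rintro rfl
      simp [hc u₀ v₀ hdv₀.ge] at hpos0
    -- The remainder of `A_{i+1} A` is constant at distance `i` and zero beyond. Below distance `i`
    -- it also vanishes, because a step along an edge cannot reach distance `i + 1` from there.
    have : G.distMatrix i = (c' / c) • M' := by
      ext u v
      rw [Matrix.smul_apply, distMatrix_apply, smul_eq_mul]
      rcases lt_trichotomy (G.dist u v) i with hlt | heq | hgt
      · have : M' u v = 0 := by
          rw [hMdef, Matrix.sub_apply, frobProj_apply_of_notMem _ _ (by simp; omega), sub_zero,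
            distMatrix_mul_adjMatrix_apply, Nat.cast_eq_zero, card_eq_zero,
            filter_eq_empty_iff]
          intro w hw
          have := hG.dist_le_succ_of_adj u ((mem_neighborFinset _ _ _).1 hw)
          omega
        simp [this, hlt.ne]
      · rw [hc u v heq.ge, if_pos heq, if_pos heq, ← hone u v heq]
        field_simp
      · simp [hc u v hgt.le, hgt.ne']
    rw [this]
    exact Subalgebra.smul_mem _ hM' _

/-- The residual of the projection onto all distance matrices is again a polynomial in `A` of degree
at most the diameter. Being orthogonal to every `A_l`, it has degree below zero, so it is zero. -/
theorem Connected.isRadial_of_mem_adjoin (hG : G.Connected)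
    (hdeg : ∀ M ∈ Algebra.adjoin ℝ {G.adjMatrix ℝ},
      ∃ f : ℝ[X], f.natDegree ≤ G.diam ∧ aeval (G.adjMatrix ℝ) f = M)
    (h : ∀ i, G.distMatrix i ∈ Algebra.adjoin ℝ {G.adjMatrix ℝ}) {M : Matrix V V ℝ}
    (hM : M ∈ Algebra.adjoin ℝ {G.adjMatrix ℝ}) : G.IsRadial M := by
  obtain ⟨f, hf, hfM⟩ := hdeg (M - frobProj (range (G.diam + 1)) G.distMatrix M)
    (sub_mem hM (sum_mem fun l _ => Subalgebra.smul_mem _ (h l) _))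
  have hlt : f.degree < (0 : ℕ) := by
    refine hG.degree_lt_of_frob_eq_zero hf fun l _ h2 => ?_
    rw [hfM, map_sub, LinearMap.sub_apply, frob_frobProj (fun a _ b _ => frob_distMatrix_of_ne)
      (fun a ha => (hG.frob_distMatrix_self_pos (by grind)).ne') _ (by grind), sub_self]
  have hf0 : f = 0 := by
    rw [← degree_eq_bot]
    exact Nat.WithBot.lt_zero_iff.1 hlt
  rw [hf0, map_zero, eq_comm, sub_eq_zero] at hfM
  rw [hfM]
  exact isRadial_frobProj _ _

theorem Connected.isDistanceRegular_of_forall (hG : G.Connected)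
    (hb : ∀ u v u' v' : V, G.dist u v = G.dist u' v' →
      ((G.neighborFinset v).filter (fun w => G.dist u w = G.dist u v + 1)).card =
      ((G.neighborFinset v').filter (fun w => G.dist u' w = G.dist u' v' + 1)).card)
    (hc : ∀ u v u' v' : V, G.dist u v = G.dist u' v' →
      ((G.neighborFinset v).filter (fun w => G.dist u w + 1 = G.dist u v)).card =
      ((G.neighborFinset v').filter (fun w => G.dist u' w + 1 = G.dist u' v')).card) :
    G.IsDistanceRegular := by
  have key : ∀ F : V → V → ℕ, (∀ u v u' v', G.dist u v = G.dist u' v' → F u v = F u' v') →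
      ∃ b : ℕ → ℕ, ∀ u v, F u v = b (G.dist u v) := by
    intro F hF
    refine ⟨fun i => if h : ∃ p : V × V, G.dist p.1 p.2 = i then F h.choose.1 h.choose.2 else 0,
      fun u v => ?_⟩
    have h : ∃ p : V × V, G.dist p.1 p.2 = G.dist u v := ⟨(u, v), rfl⟩
    simp only [dif_pos h]
    exact hF _ _ _ _ h.choose_spec.symm
  obtain ⟨b, hb⟩ := key _ hb
  obtain ⟨c, hc⟩ := key _ hc
  exact ⟨hG, b, c, fun u v => ⟨hb u v, hc u v⟩⟩

/-- The entries of `A_i A` count the neighbours at distance `i`. This product lies in the adjacency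
algebra, hence is radial. -/
theorem Connected.isDistanceRegular_of_distMatrix_mem (hG : G.Connected)
    (hdeg : ∀ M ∈ Algebra.adjoin ℝ {G.adjMatrix ℝ},
      ∃ f : ℝ[X], f.natDegree ≤ G.diam ∧ aeval (G.adjMatrix ℝ) f = M)
    (hJ : Matrix.of (fun _ _ => 1) ∈ Algebra.adjoin ℝ {G.adjMatrix ℝ})
    (h : G.distMatrix G.diam ∈ Algebra.adjoin ℝ {G.adjMatrix ℝ}) : G.IsDistanceRegular := by
  have hmem := hG.distMatrix_mem_adjoin hdeg hJ h
  have key : ∀ i u v u' v', G.dist u v = G.dist u' v' →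
      ((G.neighborFinset v).filter (fun w => G.dist u w = i)).card =
      ((G.neighborFinset v').filter (fun w => G.dist u' w = i)).card := by
    intro i u v u' v' huv
    obtain ⟨w, hw⟩ := hG.isRadial_of_mem_adjoin hdeg hmem
      (mul_mem (hmem i) (Algebra.self_mem_adjoin_singleton ℝ _))
    have h1 := distMatrix_mul_adjMatrix_apply (G := G) i u v
    have h2 := distMatrix_mul_adjMatrix_apply (G := G) i u' v'
    rw [hw] at h1 h2
    rw [huv, h2] at h1
    exact_mod_cast h1.symm
  refine hG.isDistanceRegular_of_forall (fun u v u' v' huv => ?_) fun u v u' v' huv => ?_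
  · rw [huv]
    exact key _ u v u' v' huv
  · rw [huv]
    rcases Nat.eq_zero_or_pos (G.dist u' v') with h0 | hpos
    · simp [h0]
    · have := key (G.dist u' v' - 1) u v u' v' huv
      simpa only [show ∀ n, n + 1 = G.dist u' v' ↔ n = G.dist u' v' - 1 by omega] using this

/-! ### Radial functions and the adjacency algebra of a distance-regular graph. -/

/-- Regularity eliminates the neighbours at equal distance, leaving only the two counts `b` and `c`.
The truncated `G.dist u v - 1` is harmless: at distance zero its coefficient is zero. -/
theorem Connected.sum_neighborFinset_radial (hG : G.Connected) {k : ℕ}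
    (hreg : G.IsRegularOfDegree k) (f : ℕ → ℝ) (u v : V) :
    ∑ w ∈ G.neighborFinset v, f (G.dist u w) = k * f (G.dist u v) +
      ((G.neighborFinset v).filter (fun w => G.dist u w = G.dist u v + 1)).card *
        (f (G.dist u v + 1) - f (G.dist u v)) +
      ((G.neighborFinset v).filter (fun w => G.dist u w + 1 = G.dist u v)).card *
        (f (G.dist u v - 1) - f (G.dist u v)) := by
  have hterm : ∀ w ∈ G.neighborFinset v, f (G.dist u w) = f (G.dist u v) +
      (if G.dist u w = G.dist u v + 1 then f (G.dist u v + 1) - f (G.dist u v) else 0) +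
      (if G.dist u w + 1 = G.dist u v then f (G.dist u v - 1) - f (G.dist u v) else 0) := by
    intro w hw
    rw [mem_neighborFinset] at hw
    have h1 := hG.dist_le_succ_of_adj u hw
    have h2 := hG.dist_le_succ_of_adj u hw.symm
    rcases (by omega : G.dist u w = G.dist u v ∨ G.dist u w = G.dist u v + 1 ∨
      G.dist u w + 1 = G.dist u v) with h | h | h
    · simp [h]
    · simp [h]
      omega
    · rw [if_neg (by omega), if_pos h, show G.dist u w = G.dist u v - 1 by omega]
      ring
  rw [sum_congr rfl hterm, sum_add_distrib, sum_add_distrib, sum_const, ← sum_filter, sum_const,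
    ← sum_filter, sum_const, card_neighborFinset_eq_degree, hreg v]
  simp only [nsmul_eq_mul]

theorem IsDistanceRegular.isRadial_aeval {k : ℕ} (h : G.IsDistanceRegular)
    (hreg : G.IsRegularOfDegree k) (f : ℝ[X]) : G.IsRadial (aeval (G.adjMatrix ℝ) f) := by
  obtain ⟨hG, b, c, hbc⟩ := h
  have hpow : ∀ i, G.IsRadial (G.adjMatrix ℝ ^ i) := by
    intro i
    induction i with
    | zero =>
      refine ⟨fun i => if i = 0 then 1 else 0, fun u v => ?_⟩
      simp [Matrix.one_apply, hG.dist_eq_zero_iff]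
    | succ i ih =>
      obtain ⟨w, hw⟩ := ih
      refine ⟨fun i => k * w i + b i * (w (i + 1) - w i) + c i * (w (i - 1) - w i),
        fun u v => ?_⟩
      rw [pow_succ, mul_adjMatrix_apply]
      simp only [hw]
      rw [hG.sum_neighborFinset_radial hreg, (hbc u v).1, (hbc u v).2]
  choose w hw using hpow
  refine ⟨fun l => ∑ i ∈ range (f.natDegree + 1), f.coeff i * w i l, fun u v => ?_⟩
  rw [aeval_eq_sum_range, Matrix.sum_apply]
  simp [hw]

/-- The expansion of `A ^ i` in distance matrices stops at `A_i`, with positive coefficient there,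
so this triangular system can be solved for `A_i`. -/
theorem IsDistanceRegular.exists_distMatrix_eq_aeval {k : ℕ} (h : G.IsDistanceRegular)
    (hreg : G.IsRegularOfDegree k) (i : ℕ) :
    ∃ f : ℝ[X], f.natDegree ≤ i ∧ aeval (G.adjMatrix ℝ) f = G.distMatrix i := by
  have hG := h.1
  induction i using Nat.strong_induction_on with
  | _ i ih =>
    rcases lt_or_ge G.diam i with hi | hi
    · exact ⟨0, by simp, by simp [distMatrix_eq_zero hG hi]⟩
    obtain ⟨w, hw⟩ := h.isRadial_aeval hreg (X ^ i)
    rw [map_pow, aeval_X] at hw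
    obtain ⟨u₀, v₀, huv⟩ := hG.exists_dist_eq_of_le_diam hi
    have hwi : w i ≠ 0 := by
      have := hG.adjMatrix_pow_dist_pos u₀ v₀
      rw [huv, hw, huv] at this
      exact this.ne'
    choose f hf hfA using ih
    refine ⟨C (w i)⁻¹ * (X ^ i - ∑ l : Fin i, C (w l) * f l l.2), ?_, ?_⟩
    · refine (natDegree_C_mul_le _ _).trans ((natDegree_sub_le _ _).trans (max_le ?_ ?_))
      · simp
      · exact natDegree_sum_le_of_forall_le _ _ fun l _ =>
          (natDegree_C_mul_le _ _).trans ((hf l l.2).trans l.2.le)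
    · ext u v
      simp only [map_mul, map_sub, map_sum, map_pow, aeval_X, aeval_C, hfA,
        ← Algebra.smul_def, Matrix.smul_apply, Matrix.sub_apply, Matrix.sum_apply, hw,
        distMatrix_apply, smul_eq_mul, mul_ite, mul_one, mul_zero]
      rw [Fin.sum_univ_eq_sum_range (fun l => if G.dist u v = l then w l else 0) i,
        sum_ite_eq]
      rcases lt_trichotomy (G.dist u v) i with hlt | heq | hgt
      · simp [hlt, hlt.ne]
      · simp [heq, hwi]
      · have h0 := hw u v
        rw [Connected.adjMatrix_pow_apply_eq_zero hgt] at h0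
        simp [← h0, hgt.ne']

end

end SimpleGraph

/-! ### Spectral decomposition of the adjacency matrix. -/

namespace SimpleGraph

section

set_option linter.unusedSectionVars false

open Finset Polynomial Matrix

variable {V : Type*} [Fintype V] [DecidableEq V] {G : SimpleGraph V} [DecidableRel G.Adj]

theorem toEuclideanCLM_idempotent (j : ℕ) :
    toEuclideanCLM (n := V) (𝕜 := ℝ) (G.idempotent j) =
      (Module.End.eigenspace G.adjOp (G.eigenval j)).starProjection :=
  (toEuclideanCLM (n := V) (𝕜 := ℝ)).apply_symm_apply _

theorem adjMatrix_mul_idempotent (j : ℕ) :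
    G.adjMatrix ℝ * G.idempotent j = G.eigenval j • G.idempotent j := by
  apply EquivLike.injective (toEuclideanCLM (n := V) (𝕜 := ℝ))
  rw [map_mul, map_smul, toEuclideanCLM_idempotent]
  ext1 x
  exact Module.End.mem_eigenspace_iff.1
    (Submodule.starProjection_apply_mem (Module.End.eigenspace G.adjOp (G.eigenval j)) x)

theorem idempotent_mul_self (j : ℕ) : G.idempotent j * G.idempotent j = G.idempotent j := by
  apply EquivLike.injective (toEuclideanCLM (n := V) (𝕜 := ℝ))
  rw [map_mul, toEuclideanCLM_idempotent]
  exact Submodule.isIdempotentElem_starProjection _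

theorem idempotent_mulVec_of_eigen {j : ℕ} {x : V → ℝ}
    (h : G.adjMatrix ℝ *ᵥ x = G.eigenval j • x) : G.idempotent j *ᵥ x = x := by
  have hx : WithLp.toLp 2 x ∈ Module.End.eigenspace G.adjOp (G.eigenval j) := by
    rw [Module.End.mem_eigenspace_iff]
    exact congrArg (WithLp.toLp 2) h
  have h1 := Submodule.starProjection_eq_self_iff.2 hx
  rw [← toEuclideanCLM_idempotent, toEuclideanCLM_toLp] at h1
  exact (WithLp.toLp_injective 2) h1

theorem transpose_idempotent (j : ℕ) : (G.idempotent j)ᵀ = G.idempotent j := by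
  have h : star (G.idempotent j) = G.idempotent j := by
    apply EquivLike.injective (toEuclideanCLM (n := V) (𝕜 := ℝ))
    rw [map_star, toEuclideanCLM_idempotent]
    exact isSelfAdjoint_starProjection _
  rwa [star_eq_conjTranspose, conjTranspose_eq_transpose_of_trivial] at h

theorem trace_idempotent (j : ℕ) :
    (G.idempotent j).trace =
      Module.finrank ℝ (Module.End.eigenspace G.adjOp (G.eigenval j)) := by
  set K := Module.End.eigenspace G.adjOp (G.eigenval j)
  have h : LinearMap.IsProj K (K.starProjection : EuclideanSpace ℝ V →ₗ[ℝ] EuclideanSpace ℝ V) :=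
    ⟨fun x => K.starProjection_apply_mem x, fun x hx => Submodule.starProjection_eq_self_iff.2 hx⟩
  rw [← h.trace, ← toEuclideanCLM_idempotent, coe_toEuclideanCLM_eq_toEuclideanLin]
  rw [toEuclideanLin_eq_toLin_orthonormal, Matrix.trace_toLin_eq]

theorem mem_distinctEigenvalues {μ : ℝ} :
    μ ∈ G.distinctEigenvalues ↔ Module.End.HasEigenvalue G.adjOp μ := by
  simp [distinctEigenvalues]

theorem eigenval_mem {j : ℕ} (hj : j < G.distinctEigenvalues.card) :
    G.eigenval j ∈ G.distinctEigenvalues := by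
  rw [eigenval, dif_pos hj]
  exact orderEmbOfFin_mem _ _ _

theorem eigenval_lt {i j : ℕ} (hij : i < j) (hj : j < G.distinctEigenvalues.card) :
    G.eigenval j < G.eigenval i := by
  rw [eigenval, eigenval, dif_pos hj, dif_pos (hij.trans hj)]
  exact (orderEmbOfFin _ rfl).strictMono (Fin.rev_lt_rev.2 (by simpa using hij))

theorem eigenval_le {i j : ℕ} (hij : i ≤ j) (hj : j < G.distinctEigenvalues.card) :
    G.eigenval j ≤ G.eigenval i := by
  rcases hij.eq_or_lt with rfl | h
  · rfl
  · exact (eigenval_lt h hj).le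

theorem eigenval_injOn :
    Set.InjOn G.eigenval (range G.distinctEigenvalues.card : Set ℕ) := by
  intro i hi j hj h
  simp only [coe_range, Set.mem_Iio] at hi hj
  rcases lt_trichotomy i j with hij | hij | hij
  · exact absurd h (eigenval_lt hij hj).ne'
  · exact hij
  · exact absurd h (eigenval_lt hij hi).ne

theorem image_eigenval :
    (range G.distinctEigenvalues.card).image G.eigenval = G.distinctEigenvalues := by
  refine eq_of_subset_of_card_le (fun x hx => ?_) ?_
  · obtain ⟨j, hj, rfl⟩ := mem_image.1 hx
    exact eigenval_mem (mem_range.1 hj)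
  · rw [card_image_of_injOn eigenval_injOn, card_range]

theorem isSymmetric_adjOp : (G.adjOp).IsSymmetric :=
  isSymmetric_toEuclideanLin_iff.2 (isHermitian_adjMatrix ℝ G)

theorem sum_idempotent : ∑ j ∈ range G.distinctEigenvalues.card, G.idempotent j = 1 := by
  apply EquivLike.injective (toEuclideanCLM (n := V) (𝕜 := ℝ))
  rw [map_sum, map_one]
  simp only [toEuclideanCLM_idempotent]
  have h1 := sum_image (f := fun μ => (Module.End.eigenspace G.adjOp μ).starProjection)
    (eigenval_injOn (G := G))
  rw [← h1, image_eigenval]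
  ext1 x
  rw [_root_.sum_apply,
    Finset.sum_subtype _ (fun μ => mem_distinctEigenvalues (G := G))
      (fun μ => (Module.End.eigenspace G.adjOp μ).starProjection x)]
  refine OrthogonalFamily.sum_projection_of_mem_iSup
    (V := fun μ : Module.End.Eigenvalues G.adjOp => Module.End.eigenspace G.adjOp μ)
    isSymmetric_adjOp.orthogonalFamily_eigenspaces' x ?_
  have h2 := isSymmetric_adjOp (G := G).orthogonalComplement_iSup_eigenspaces_eq_bot'
  rw [Submodule.orthogonal_eq_bot_iff] at h2
  exact h2 ▸ Submodule.mem_top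

theorem aeval_mul_idempotent (f : ℝ[X]) (j : ℕ) :
    aeval (G.adjMatrix ℝ) f * G.idempotent j = f.eval (G.eigenval j) • G.idempotent j := by
  induction f using Polynomial.induction_on' with
  | add p q hp hq => rw [map_add, add_mul, hp, hq, eval_add, add_smul]
  | monomial n a =>
    rw [aeval_monomial, eval_monomial, ← Algebra.smul_def, smul_mul_assoc, mul_smul]
    congr 1
    induction n with
    | zero => simp
    | succ n ih =>
      rw [pow_succ, mul_assoc, adjMatrix_mul_idempotent, mul_smul_comm, ih, smul_smul, pow_succ,
        mul_comm]

theorem aeval_eq_sum_idempotent (f : ℝ[X]) :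
    aeval (G.adjMatrix ℝ) f =
      ∑ j ∈ range G.distinctEigenvalues.card, f.eval (G.eigenval j) • G.idempotent j := by
  rw [← mul_one (aeval (G.adjMatrix ℝ) f), ← sum_idempotent (G := G), mul_sum]
  simp only [aeval_mul_idempotent]

/-- The polynomial that interpolates the indicator function of the `j`-th eigenvalue. -/
noncomputable def eigenBasis (G : SimpleGraph V) [DecidableRel G.Adj] (j : ℕ) : ℝ[X] :=
  Lagrange.basis (range G.distinctEigenvalues.card) G.eigenval j

theorem eval_eigenBasis {i j : ℕ} (hi : i < G.distinctEigenvalues.card)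
    (hj : j < G.distinctEigenvalues.card) :
    (G.eigenBasis i).eval (G.eigenval j) = if i = j then 1 else 0 := by
  split_ifs with h
  · subst h
    exact Lagrange.eval_basis_self eigenval_injOn (mem_range.2 hi)
  · exact Lagrange.eval_basis_of_ne h (mem_range.2 hj)

theorem aeval_eigenBasis {j : ℕ} (hj : j < G.distinctEigenvalues.card) :
    aeval (G.adjMatrix ℝ) (G.eigenBasis j) = G.idempotent j := by
  rw [aeval_eq_sum_idempotent, sum_eq_single_of_mem j (mem_range.2 hj)]
  · simp [eval_eigenBasis hj hj]
  · intro i hi hij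
    simp [eval_eigenBasis hj (mem_range.1 hi), hij.symm]

theorem idempotent_mul_of_ne {i j : ℕ} (hi : i < G.distinctEigenvalues.card)
    (hj : j < G.distinctEigenvalues.card) (h : i ≠ j) :
    G.idempotent i * G.idempotent j = 0 := by
  rw [← aeval_eigenBasis hi, aeval_mul_idempotent, eval_eigenBasis hi hj, if_neg h, zero_smul]

theorem idempotent_mem_adjoin {j : ℕ} (hj : j < G.distinctEigenvalues.card) :
    G.idempotent j ∈ Algebra.adjoin ℝ {G.adjMatrix ℝ} := by
  rw [← aeval_eigenBasis hj]
  exact aeval_mem_adjoin_singleton _ _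

/-- A polynomial in `A` depends only on its values at the `d + 1` eigenvalues, so it may be replaced
by its Lagrange interpolant. -/
theorem exists_natDegree_le_of_mem_adjoin {M : Matrix V V ℝ}
    (hM : M ∈ Algebra.adjoin ℝ {G.adjMatrix ℝ}) :
    ∃ f : ℝ[X], f.natDegree ≤ G.spectralDiam ∧ aeval (G.adjMatrix ℝ) f = M := by
  rw [Algebra.adjoin_singleton_eq_range_aeval] at hM
  obtain ⟨f, rfl⟩ := hM
  refine ⟨∑ j ∈ range G.distinctEigenvalues.card,
    C (f.eval (G.eigenval j)) * G.eigenBasis j, ?_, ?_⟩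
  · refine natDegree_sum_le_of_forall_le _ _ fun j hj => (natDegree_C_mul_le _ _).trans ?_
    rw [eigenBasis, Lagrange.natDegree_basis eigenval_injOn hj, card_range, spectralDiam]
  · rw [map_sum]
    erw [aeval_eq_sum_idempotent f]
    refine sum_congr rfl fun j hj => ?_
    rw [map_mul, aeval_C, aeval_eigenBasis (mem_range.1 hj), ← Algebra.smul_def]

theorem frob_idempotent_of_ne {i j : ℕ} (hi : i < G.distinctEigenvalues.card)
    (hj : j < G.distinctEigenvalues.card) (h : i ≠ j) :
    frob (G.idempotent i) (G.idempotent j) = 0 := by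
  rw [frob_eq_trace, transpose_idempotent, idempotent_mul_of_ne hi hj h, trace_zero]

theorem frob_idempotent_self [Nonempty V] (j : ℕ) :
    frob (G.idempotent j) (G.idempotent j) = Fintype.card V * G.avgMult j := by
  rw [frob_eq_trace, transpose_idempotent, idempotent_mul_self, trace_idempotent, avgMult]
  field_simp

theorem avgMult_pos [Nonempty V] {j : ℕ} (hj : j < G.distinctEigenvalues.card) :
    0 < G.avgMult j := by
  have h := mem_distinctEigenvalues.1 (eigenval_mem hj)
  have : 0 < Module.finrank ℝ (Module.End.eigenspace G.adjOp (G.eigenval j)) := by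
    rw [Module.finrank_pos_iff, Submodule.nontrivial_iff_ne_bot]
    exact h
  rw [avgMult]
  have hn : 0 < Fintype.card V := Fintype.card_pos
  positivity

theorem sum_dotProduct_idempotent (x : V → ℝ) :
    ∑ j ∈ range G.distinctEigenvalues.card, x ⬝ᵥ (G.idempotent j *ᵥ x) = x ⬝ᵥ x := by
  rw [← dotProduct_sum, ← sum_mulVec, sum_idempotent (G := G), one_mulVec]

theorem dotProduct_adjMatrix_mulVec (x : V → ℝ) :
    x ⬝ᵥ (G.adjMatrix ℝ *ᵥ x) = ∑ j ∈ range G.distinctEigenvalues.card,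
      G.eigenval j * (x ⬝ᵥ (G.idempotent j *ᵥ x)) := by
  have h := aeval_eq_sum_idempotent (G := G) X
  rw [aeval_X] at h
  conv_lhs => rw [h]
  rw [sum_mulVec, dotProduct_sum]
  simp [smul_mulVec]

theorem dotProduct_idempotent_nonneg (j : ℕ) (x : V → ℝ) :
    0 ≤ x ⬝ᵥ (G.idempotent j *ᵥ x) := by
  have h : x ⬝ᵥ (G.idempotent j *ᵥ x) =
      (G.idempotent j *ᵥ x) ⬝ᵥ (G.idempotent j *ᵥ x) := by
    conv_lhs => rw [← idempotent_mul_self, ← mulVec_mulVec, dotProduct_mulVec,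
      ← mulVec_transpose, transpose_idempotent]
  rw [h]
  exact sum_nonneg fun v _ => mul_self_nonneg _

/-! ### Regular graphs: the largest eigenvalue and Rayleigh bounds. -/

theorem IsRegularOfDegree.adjMatrix_mulVec_one {k : ℕ} (hreg : G.IsRegularOfDegree k) :
    G.adjMatrix ℝ *ᵥ (fun _ => 1) = (k : ℝ) • fun _ => 1 := by
  ext v
  simp [hreg v]

theorem IsRegularOfDegree.sum_adj_sq_sub {k : ℕ} (hreg : G.IsRegularOfDegree k) (x : V → ℝ) :
    ∑ u, ∑ v ∈ G.neighborFinset u, (x u - x v) ^ 2 =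
      2 * (k * (x ⬝ᵥ x) - x ⬝ᵥ (G.adjMatrix ℝ *ᵥ x)) := by
  have h1 : ∑ u, ∑ v ∈ G.neighborFinset u, x v ^ 2 = k * (x ⬝ᵥ x) := by
    have : ∀ u, ∑ v ∈ G.neighborFinset u, x v ^ 2 =
        ∑ v, if G.Adj u v then x v ^ 2 else 0 := by
      intro u
      rw [← sum_filter, neighborFinset_eq_filter]
    simp only [this]
    rw [sum_comm, dotProduct, mul_sum]
    refine sum_congr rfl fun v _ => ?_
    simp only [G.adj_comm _ v]
    rw [← sum_filter, ← neighborFinset_eq_filter, sum_const, card_neighborFinset_eq_degree,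
      hreg v, nsmul_eq_mul]
    ring
  have h2 : ∑ u, ∑ v ∈ G.neighborFinset u, x u ^ 2 = k * (x ⬝ᵥ x) := by
    rw [dotProduct, mul_sum]
    refine sum_congr rfl fun u _ => ?_
    rw [sum_const, card_neighborFinset_eq_degree, hreg u, nsmul_eq_mul]
    ring
  have h3 : ∑ u, ∑ v ∈ G.neighborFinset u, x u * x v = x ⬝ᵥ (G.adjMatrix ℝ *ᵥ x) := by
    simp [dotProduct, adjMatrix_mulVec_apply, mul_sum]
  have h4 : ∀ u v, (x u - x v) ^ 2 = x u ^ 2 + x v ^ 2 - 2 * (x u * x v) := by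
    intros
    ring
  have h5 : ∑ u, ∑ v ∈ G.neighborFinset u, 2 * (x u * x v) =
      2 * (x ⬝ᵥ (G.adjMatrix ℝ *ᵥ x)) := by
    rw [← h3, mul_sum]
    simp only [mul_sum]
  simp only [h4, sum_sub_distrib, sum_add_distrib, h1, h2, h5]
  ring

theorem IsRegularOfDegree.eigenvalue_le {k : ℕ} (hreg : G.IsRegularOfDegree k) {μ : ℝ}
    (h : μ ∈ G.distinctEigenvalues) : μ ≤ k := by
  obtain ⟨x, hx, hx0⟩ := (mem_distinctEigenvalues.1 h).exists_hasEigenvector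
  rw [Module.End.mem_eigenspace_iff] at hx
  have hA : G.adjMatrix ℝ *ᵥ x.ofLp = μ • x.ofLp := congrArg WithLp.ofLp hx
  have h1 := hreg.sum_adj_sq_sub x.ofLp
  rw [hA, dotProduct_smul, smul_eq_mul] at h1
  have h2 : 0 ≤ ∑ u, ∑ v ∈ G.neighborFinset u, (x.ofLp u - x.ofLp v) ^ 2 :=
    sum_nonneg fun _ _ => sum_nonneg fun _ _ => sq_nonneg _
  have h3 : 0 < x.ofLp ⬝ᵥ x.ofLp := by
    refine lt_of_le_of_ne (sum_nonneg fun v _ => mul_self_nonneg _) fun h => hx0 ?_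
    rw [eq_comm, dotProduct_self_eq_zero] at h
    exact WithLp.ofLp_injective 2 h
  nlinarith

theorem IsRegularOfDegree.mem_distinctEigenvalues [Nonempty V] {k : ℕ}
    (hreg : G.IsRegularOfDegree k) : (k : ℝ) ∈ G.distinctEigenvalues := by
  rw [SimpleGraph.mem_distinctEigenvalues]
  refine Module.End.hasEigenvalue_of_hasEigenvector (x := WithLp.toLp 2 fun _ => 1) ⟨?_, ?_⟩
  · rw [Module.End.mem_eigenspace_iff]
    exact congrArg (WithLp.toLp 2) hreg.adjMatrix_mulVec_one
  · intro h
    have := congrFun (congrArg WithLp.ofLp h) (Classical.arbitrary V)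
    simp at this

theorem IsRegularOfDegree.eigenval_zero [Nonempty V] {k : ℕ} (hreg : G.IsRegularOfDegree k) :
    G.eigenval 0 = k := by
  have hk := hreg.mem_distinctEigenvalues
  have hpos : 0 < G.distinctEigenvalues.card := card_pos.2 ⟨_, hk⟩
  refine le_antisymm (hreg.eigenvalue_le (eigenval_mem hpos)) ?_
  rw [← image_eigenval] at hk
  obtain ⟨j, hj, h⟩ := mem_image.1 hk
  rw [← h]
  exact eigenval_le (Nat.zero_le j) (mem_range.1 hj)

/-- The columns of `E_0` lie in the kernel of the Laplacian, so connectedness makes them constant.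
Symmetry makes the whole matrix constant, and fixing the all-ones vector determines the value. -/
theorem Connected.idempotent_zero_apply (hG : G.Connected) {k : ℕ} (hreg : G.IsRegularOfDegree k)
    (u v : V) : G.idempotent 0 u v = 1 / Fintype.card V := by
  have hne := hG.nonempty
  have hcol : ∀ u u' v, G.idempotent 0 u v = G.idempotent 0 u' v := by
    intro u u' v
    have h1 : G.adjMatrix ℝ *ᵥ (fun w => G.idempotent 0 w v) =
        (k : ℝ) • fun w => G.idempotent 0 w v := by
      ext w
      have := congr_fun₂ (adjMatrix_mul_idempotent (G := G) 0) w v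
      rw [hreg.eigenval_zero] at this
      simpa [Matrix.mul_apply, mulVec, dotProduct] using this
    have h2 : G.lapMatrix ℝ *ᵥ (fun w => G.idempotent 0 w v) = 0 := by
      ext w
      have := congrFun h1 w
      rw [adjMatrix_mulVec_apply] at this
      rw [lapMatrix_mulVec_apply, this, hreg w]
      simp
    exact (lapMatrix_mulVec_eq_zero_iff_forall_reachable G).1 h2 u u' (hG.preconnected u u')
  have hrow : ∀ u v v', G.idempotent 0 u v = G.idempotent 0 u v' := by
    intro u v v'
    rw [← transpose_idempotent]
    exact hcol v v' u
  have hone := congrFun (idempotent_mulVec_of_eigen (G := G) (j := 0) (x := fun _ => 1)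
    (by rw [hreg.eigenval_zero, hreg.adjMatrix_mulVec_one])) u
  simp only [mulVec, dotProduct, mul_one, hrow u _ v, sum_const, card_univ, nsmul_eq_mul] at hone
  have hn : (Fintype.card V : ℝ) ≠ 0 := by exact_mod_cast Fintype.card_ne_zero
  field_simp
  linarith

theorem Connected.ones_mem_adjoin (hG : G.Connected) {k : ℕ} (hreg : G.IsRegularOfDegree k) :
    Matrix.of (fun _ _ => 1) ∈ Algebra.adjoin ℝ {G.adjMatrix ℝ} := by
  have hne := hG.nonempty
  have h : Matrix.of (fun _ _ => 1) = (Fintype.card V : ℝ) • G.idempotent 0 := by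
    ext u v
    have hn : (Fintype.card V : ℝ) ≠ 0 := by exact_mod_cast Fintype.card_ne_zero
    simp [hG.idempotent_zero_apply hreg, hn]
  rw [h]
  exact Subalgebra.smul_mem _
    (idempotent_mem_adjoin (card_pos.2 ⟨_, hreg.mem_distinctEigenvalues⟩)) _

theorem eigenval_spectralDiam_mul_le (x : V → ℝ) :
    G.eigenval G.spectralDiam * (x ⬝ᵥ x) ≤ x ⬝ᵥ (G.adjMatrix ℝ *ᵥ x) := by
  rw [dotProduct_adjMatrix_mulVec, ← sum_dotProduct_idempotent (G := G), mul_sum]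
  refine sum_le_sum fun j hj => mul_le_mul_of_nonneg_right ?_ (dotProduct_idempotent_nonneg j x)
  rw [mem_range] at hj
  exact eigenval_le (by rw [spectralDiam]; omega) (by rw [spectralDiam]; omega)

theorem adjMatrix_mulVec_eq_of_dotProduct_eq {x : V → ℝ}
    (h : x ⬝ᵥ (G.adjMatrix ℝ *ᵥ x) = G.eigenval G.spectralDiam * (x ⬝ᵥ x)) :
    G.adjMatrix ℝ *ᵥ x = G.eigenval G.spectralDiam • x := by
  have hps : (G.adjMatrix ℝ - G.eigenval G.spectralDiam • 1).PosSemidef := by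
    refine Matrix.PosSemidef.of_dotProduct_mulVec_nonneg ?_ fun y => ?_
    · exact (isHermitian_adjMatrix ℝ G).sub (by simp [IsHermitian])
    · rw [star_trivial, sub_mulVec, smul_mulVec, one_mulVec, dotProduct_sub, dotProduct_smul,
        smul_eq_mul, sub_nonneg]
      exact eigenval_spectralDiam_mul_le y
  have := (hps.dotProduct_mulVec_zero_iff x).1 (by
    rw [star_trivial, sub_mulVec, smul_mulVec, one_mulVec, dotProduct_sub, dotProduct_smul,
        smul_eq_mul, h, sub_self])
  rwa [sub_mulVec, smul_mulVec, one_mulVec, sub_eq_zero] at this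

/-- The component along `E_0` is the mean, with eigenvalue `k`; on all other components the
eigenvalue is at most `λ_1`. -/
theorem Connected.dotProduct_adjMatrix_mulVec_le (hG : G.Connected) {k : ℕ}
    (hreg : G.IsRegularOfDegree k) (x : V → ℝ) :
    x ⬝ᵥ (G.adjMatrix ℝ *ᵥ x) ≤ G.eigenval 1 * (x ⬝ᵥ x) +
      (k - G.eigenval 1) * ((∑ v, x v) ^ 2 / Fintype.card V) := by
  have hne := hG.nonempty
  have hpos : 0 < G.distinctEigenvalues.card := card_pos.2 ⟨_, hreg.mem_distinctEigenvalues⟩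
  obtain ⟨m, hm⟩ : ∃ m, G.distinctEigenvalues.card = m + 1 := ⟨_, (Nat.succ_pred hpos.ne').symm⟩
  have h0 : x ⬝ᵥ (G.idempotent 0 *ᵥ x) = (∑ v, x v) ^ 2 / Fintype.card V := by
    simp only [dotProduct, mulVec, hG.idempotent_zero_apply hreg, ← mul_sum]
    rw [← sum_mul]
    ring
  have h1 : ∑ j ∈ range m, G.eigenval (j + 1) * (x ⬝ᵥ (G.idempotent (j + 1) *ᵥ x)) ≤
      G.eigenval 1 * ∑ j ∈ range m, x ⬝ᵥ (G.idempotent (j + 1) *ᵥ x) := by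
    rw [mul_sum]
    refine sum_le_sum fun j hj =>
      mul_le_mul_of_nonneg_right ?_ (dotProduct_idempotent_nonneg _ x)
    rw [mem_range] at hj
    exact eigenval_le (by omega) (by omega)
  rw [dotProduct_adjMatrix_mulVec, ← sum_dotProduct_idempotent (G := G), hm, sum_range_succ',
    sum_range_succ', ← h0, hreg.eigenval_zero]
  linarith

end

end SimpleGraph

/-! ### Radial eigenvectors and condition (b). -/

namespace SimpleGraph

section

set_option linter.unusedSectionVars false

open Finset Polynomial Matrix

variable {V : Type*} [Fintype V] [DecidableEq V] {G : SimpleGraph V} [DecidableRel G.Adj]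

/-- `w` defines an eigenvector of the adjacency matrix, with eigenvalue `μ`, whose entries depend
only on the distance to `u`. -/
def IsRadialEigen (G : SimpleGraph V) [DecidableRel G.Adj] (u : V) (w : ℕ → ℝ) (μ : ℝ) : Prop :=
  ∀ v, ∑ x ∈ G.neighborFinset v, w (G.dist u x) = μ * w (G.dist u v)

theorem isRadialEigen_iff {u : V} {w : ℕ → ℝ} {μ : ℝ} :
    G.IsRadialEigen u w μ ↔
      G.adjMatrix ℝ *ᵥ (fun v => w (G.dist u v)) = μ • fun v => w (G.dist u v) := by
  simp only [IsRadialEigen, funext_iff, adjMatrix_mulVec_apply, Pi.smul_apply, smul_eq_mul]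

theorem isRadialEigen_of_idempotent {j : ℕ} {w : ℕ → ℝ}
    (h : ∀ u v, G.idempotent j u v = w (G.dist u v)) (u : V) :
    G.IsRadialEigen u w (G.eigenval j) := by
  intro v
  have h1 := congrArg transpose (adjMatrix_mul_idempotent (G := G) j)
  rw [transpose_mul, transpose_smul, transpose_idempotent, transpose_adjMatrix] at h1
  have h2 := congr_fun₂ h1 u v
  rw [mul_adjMatrix_apply] at h2
  simpa [h] using h2

theorem IsRadialEigen.recurrence (hG : G.Connected) {k : ℕ} (hreg : G.IsRegularOfDegree k)
    {u : V} {w : ℕ → ℝ} {μ : ℝ} (h : G.IsRadialEigen u w μ) {v : V} {i : ℕ}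
    (hv : G.dist u v = i) :
    k * w i + ((G.neighborFinset v).filter (fun x => G.dist u x = i + 1)).card *
      (w (i + 1) - w i) + ((G.neighborFinset v).filter (fun x => G.dist u x + 1 = i)).card *
      (w (i - 1) - w i) = μ * w i := by
  subst hv
  rw [← h v, hG.sum_neighborFinset_radial hreg]

theorem Connected.card_filter_dist_succ_pos (hG : G.Connected) {u v : V} {i : ℕ}
    (hv : G.dist u v = i + 1) :
    0 < ((G.neighborFinset v).filter (fun x => G.dist u x + 1 = i + 1)).card := by
  obtain ⟨y, hy, hd⟩ := hG.exists_adj_dist hv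
  exact card_pos.2 ⟨y, by simp [hy, hd]⟩

/-- Two consecutive zeros propagate down to distance zero, because the coefficient `c` in the
recurrence is positive at every positive distance. -/
theorem IsRadialEigen.zero_eq_zero (hG : G.Connected) {k : ℕ} (hreg : G.IsRegularOfDegree k)
    {u : V} {w : ℕ → ℝ} {μ : ℝ} (h : G.IsRadialEigen u w μ) {v : V} {i : ℕ}
    (hi : i + 1 ≤ G.dist u v) (h0 : w i = 0) (h1 : w (i + 1) = 0) : w 0 = 0 := by
  induction i with
  | zero => exact h0
  | succ i ih =>
    obtain ⟨x, hx⟩ := hG.exists_dist_eq (show i + 1 ≤ G.dist u v by omega)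
    have hr := h.recurrence hG hreg hx
    have hc := hG.card_filter_dist_succ_pos hx
    rw [h0, h1] at hr
    simp only [mul_zero, sub_zero, zero_add, Nat.add_sub_cancel, mul_eq_zero,
      Nat.cast_eq_zero] at hr
    exact ih (by omega) (hr.resolve_left hc.ne') h0

theorem sum_sum_sq_sub (x : V → ℝ) :
    ∑ u, ∑ v, (x u - x v) ^ 2 = 2 * (Fintype.card V * (x ⬝ᵥ x) - (∑ v, x v) ^ 2) := by
  have h4 : ∀ u v, (x u - x v) ^ 2 = x u * x u + x v * x v - 2 * (x u * x v) := by
    intros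
    ring
  have h1 : ∑ _u : V, ∑ v, x v * x v = Fintype.card V * (x ⬝ᵥ x) := by
    rw [sum_const, card_univ, nsmul_eq_mul, dotProduct]
  have h2 : ∑ u, ∑ _v : V, x u * x u = Fintype.card V * (x ⬝ᵥ x) := by
    rw [sum_comm, h1]
  have h3 : ∑ u, ∑ v, 2 * (x u * x v) = 2 * (∑ v, x v) ^ 2 := by
    rw [sq, sum_mul_sum, mul_sum]
    simp only [mul_sum]
  simp only [h4, sum_sub_distrib, sum_add_distrib, h1, h2, h3]
  ring

theorem abs_sub_le_sum_abs (w : ℕ → ℝ) (a n : ℕ) :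
    |w a - w (a + n)| ≤ ∑ l ∈ range (a + n), |w l - w (l + 1)| -
      ∑ l ∈ range a, |w l - w (l + 1)| := by
  induction n with
  | zero => simp
  | succ n ih =>
    rw [← add_assoc, sum_range_succ]
    have := abs_sub_le (w a) (w (a + n)) (w (a + n + 1))
    linarith

theorem sq_sub_le_sq_sub_sum_abs (w : ℕ → ℝ) (a b : ℕ) :
    (w a - w b) ^ 2 ≤ (∑ l ∈ range a, |w l - w (l + 1)| - ∑ l ∈ range b, |w l - w (l + 1)|) ^ 2 := by
  wlog h : a ≤ b generalizing a b
  · have := this b a (by omega)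
    nlinarith
  obtain ⟨n, rfl⟩ := Nat.exists_eq_add_of_le h
  rw [sq_le_sq, abs_sub_comm (∑ l ∈ range a, _)]
  exact (abs_sub_le_sum_abs w a n).trans (le_abs_self _)

/-- A radial eigenvector for the second largest eigenvalue is monotone in the distance. -/
theorem IsRadialEigen.mul_sub_nonneg (hG : G.Connected) {k : ℕ} (hreg : G.IsRegularOfDegree k)
    (hlt : G.eigenval 1 < k) {u : V} {w : ℕ → ℝ} (h : G.IsRadialEigen u w (G.eigenval 1)) {v : V}
    {i : ℕ} (hi : i + 2 ≤ G.dist u v) :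
    0 ≤ (w i - w (i + 1)) * (w (i + 1) - w (i + 2)) := by
  have hne := hG.nonempty
  have hn : (0 : ℝ) < Fintype.card V := by exact_mod_cast Fintype.card_pos
  -- `W` has the same increments as `w` up to sign, all made nonnegative: the energy along edges is
  -- unchanged, while no difference between two vertices shrinks in absolute value.
  set W : ℕ → ℝ := fun i => ∑ l ∈ range i, |w l - w (l + 1)| with hW
  have hWs : ∀ i, W (i + 1) = W i + |w i - w (i + 1)| := fun i => sum_range_succ _ _
  set x : V → ℝ := fun v => w (G.dist u v) with hx
  set g : V → ℝ := fun v => W (G.dist u v) with hg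
  have hA := isRadialEigen_iff.1 h
  have hsum : ∑ v, x v = 0 := by
    have h1 : (fun _ => 1) ⬝ᵥ (G.adjMatrix ℝ *ᵥ x) = k * ∑ v, x v := by
      rw [dotProduct_mulVec, ← mulVec_transpose, transpose_adjMatrix, hreg.adjMatrix_mulVec_one]
      simp [dotProduct, mul_sum]
    rw [hA, dotProduct_smul] at h1
    simp only [dotProduct, one_mul, smul_eq_mul] at h1
    have h2 : (k - G.eigenval 1) * ∑ v, x v = 0 := by linarith
    exact (mul_eq_zero.1 h2).resolve_left (by linarith)
  have hen : ∑ v, ∑ y ∈ G.neighborFinset v, (g v - g y) ^ 2 =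
      ∑ v, ∑ y ∈ G.neighborFinset v, (x v - x y) ^ 2 := by
    refine sum_congr rfl fun v _ => sum_congr rfl fun y hy => ?_
    rw [mem_neighborFinset] at hy
    have h1 := hG.dist_le_succ_of_adj u hy
    have h2 := hG.dist_le_succ_of_adj u hy.symm
    simp only [hg, hx]
    rcases (by omega : G.dist u y = G.dist u v ∨ G.dist u y = G.dist u v + 1 ∨
      G.dist u v = G.dist u y + 1) with h | h | h
    · simp [h]
    · rw [h, hWs, sub_add_cancel_left, neg_sq, sq_abs]
    · rw [h, hWs, add_sub_cancel_left, sq_abs]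
      ring
  have hle : ∀ v y, (x v - x y) ^ 2 ≤ (g v - g y) ^ 2 := fun v y =>
    sq_sub_le_sq_sub_sum_abs w _ _
  -- Among all vectors of the same edge energy, a `λ_1`-eigenvector has the largest variance. So
  -- every pairwise difference must agree in absolute value.
  have hvar : ∑ v, ∑ y, (g v - g y) ^ 2 ≤ ∑ v, ∑ y, (x v - x y) ^ 2 := by
    have h1 := hG.dotProduct_adjMatrix_mulVec_le hreg g
    rw [hreg.sum_adj_sq_sub, hreg.sum_adj_sq_sub, hA, dotProduct_smul, smul_eq_mul] at hen
    rw [sum_sum_sq_sub, sum_sum_sq_sub, hsum]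
    have h2 : (k - G.eigenval 1) * (g ⬝ᵥ g - (∑ v, g v) ^ 2 / Fintype.card V) ≤
        (k - G.eigenval 1) * (x ⬝ᵥ x) := by linarith
    have h3 := le_of_mul_le_mul_left h2 (by linarith)
    have h4 := mul_le_mul_of_nonneg_left h3 hn.le
    rw [mul_sub, mul_div_cancel₀ _ hn.ne'] at h4
    linarith
  have heq : ∀ v y, (x v - x y) ^ 2 = (g v - g y) ^ 2 := by
    have h1 : ∑ v, ∑ y, (x v - x y) ^ 2 = ∑ v, ∑ y, (g v - g y) ^ 2 :=
      le_antisymm (sum_le_sum fun v _ => sum_le_sum fun y _ => hle v y) hvar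
    intro v y
    have h2 := (sum_eq_sum_iff_of_le fun v _ => sum_le_sum fun y _ => hle v y).1 h1 v
      (mem_univ v)
    exact (sum_eq_sum_iff_of_le fun y _ => hle v y).1 h2 y (mem_univ y)
  obtain ⟨a, ha⟩ := hG.exists_dist_eq (show i ≤ G.dist u v by omega)
  obtain ⟨b, hb⟩ := hG.exists_dist_eq hi
  have h1 := heq a b
  simp only [hx, hg, ha, hb] at h1
  rw [show W (i + 2) = W i + |w i - w (i + 1)| + |w (i + 1) - w (i + 2)| by
    rw [show i + 2 = i + 1 + 1 from rfl, hWs, hWs]] at h1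
  -- Vertices at distances `i` and `i + 2` give equality in the triangle inequality for two
  -- consecutive increments, which thus have no opposite signs.
  have h2 := abs_mul_abs_self (w i - w (i + 1))
  have h3 := abs_mul_abs_self (w (i + 1) - w (i + 2))
  have h4 : (w i - w (i + 1)) * (w (i + 1) - w (i + 2)) =
    |w i - w (i + 1)| * |w (i + 1) - w (i + 2)| := by nlinarith
  rw [h4]
  positivity

/-- A radial eigenvector for the smallest eigenvalue alternates in sign. -/
theorem IsRadialEigen.mul_succ_neg (hG : G.Connected) {k : ℕ} (hreg : G.IsRegularOfDegree k)
    {u : V} {w : ℕ → ℝ} (h : G.IsRadialEigen u w (G.eigenval G.spectralDiam)) (h0 : w 0 ≠ 0)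
    {v : V} {i : ℕ} (hi : i + 1 ≤ G.dist u v) : w i * w (i + 1) < 0 := by
  -- Forcing alternating signs keeps the norm and does not increase the quadratic form. Minimality
  -- of `λ_d` then makes `W` an eigenvector too, with equality on every edge.
  set W : ℕ → ℝ := fun i => (-1) ^ i * |w i| with hW
  set x : V → ℝ := fun v => w (G.dist u v) with hx
  set g : V → ℝ := fun v => W (G.dist u v) with hg
  have hsq : ∀ i, W i * W i = w i * w i := by
    intro i
    rw [hW]
    simp only
    rw [mul_mul_mul_comm, abs_mul_abs_self, ← mul_pow]
    simp
  have hsucc : ∀ i, W i * W (i + 1) = -|w i * w (i + 1)| := by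
    intro i
    have : (-1 : ℝ) ^ i * (-1) ^ i = 1 := by rw [← mul_pow]; simp
    simp only [hW, pow_succ, abs_mul]
    linear_combination (-|w i| * |w (i + 1)|) * this
  have hA := isRadialEigen_iff.1 h
  have hgx : g ⬝ᵥ g = x ⬝ᵥ x := sum_congr rfl fun v _ => hsq _
  have hle : ∀ v, ∀ y ∈ G.neighborFinset v, g v * g y ≤ x v * x y := by
    intro v y hy
    rw [mem_neighborFinset] at hy
    have h1 := hG.dist_le_succ_of_adj u hy
    have h2 := hG.dist_le_succ_of_adj u hy.symm
    simp only [hg, hx]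
    rcases (by omega : G.dist u y = G.dist u v ∨ G.dist u y = G.dist u v + 1 ∨
      G.dist u v = G.dist u y + 1) with h | h | h
    · rw [h, hsq]
    · rw [h, hsucc]
      exact neg_abs_le _
    · rw [h, mul_comm, hsucc, mul_comm (w _)]
      exact neg_abs_le _
  have hquad : ∀ z : V → ℝ, z ⬝ᵥ (G.adjMatrix ℝ *ᵥ z) =
      ∑ v, ∑ y ∈ G.neighborFinset v, z v * z y := fun z => by
    simp [dotProduct, mul_sum]
  have hxA : x ⬝ᵥ (G.adjMatrix ℝ *ᵥ x) = G.eigenval G.spectralDiam * (x ⬝ᵥ x) := by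
    rw [hA, dotProduct_smul, smul_eq_mul]
  have hgA : g ⬝ᵥ (G.adjMatrix ℝ *ᵥ g) = G.eigenval G.spectralDiam * (g ⬝ᵥ g) := by
    refine le_antisymm ?_ (eigenval_spectralDiam_mul_le g)
    rw [hgx, ← hxA, hquad, hquad]
    exact sum_le_sum fun v _ => sum_le_sum (hle v)
  have hrad : G.IsRadialEigen u W (G.eigenval G.spectralDiam) :=
    isRadialEigen_iff.2 (adjMatrix_mulVec_eq_of_dotProduct_eq hgA)
  have hterm : ∀ v, ∀ y ∈ G.neighborFinset v, g v * g y = x v * x y := by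
    have h1 : g ⬝ᵥ (G.adjMatrix ℝ *ᵥ g) = x ⬝ᵥ (G.adjMatrix ℝ *ᵥ x) := by rw [hgA, hxA, hgx]
    rw [hquad, hquad] at h1
    intro v
    exact (sum_eq_sum_iff_of_le (hle v)).1
      ((sum_eq_sum_iff_of_le fun v _ => sum_le_sum (hle v)).1 h1 v (mem_univ v))
  -- Strictness: at a zero, the recurrence for `W` is a sum of two terms of the same sign. The
  -- preceding value vanishes as well, contradicting `w 0 ≠ 0`.
  have hne : ∀ i ≤ G.dist u v, w i ≠ 0 := by
    intro i hi hwi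
    cases i with
    | zero => exact h0 hwi
    | succ j =>
      obtain ⟨y, hy⟩ := hG.exists_dist_eq hi
      have hr := hrad.recurrence hG hreg hy
      have hc := hG.card_filter_dist_succ_pos hy
      have hpow : (-1 : ℝ) ^ j ≠ 0 := pow_ne_zero _ (by norm_num)
      have hWj : W (j + 1) = 0 := by simp [hW, hwi]
      rw [hWj, mul_zero, mul_zero, zero_add, sub_zero, sub_zero, Nat.add_sub_cancel] at hr
      have hfac : (-1 : ℝ) ^ j *
          (((G.neighborFinset y).filter (fun x => G.dist u x = j + 1 + 1)).card * |w (j + 2)| +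
          ((G.neighborFinset y).filter (fun x => G.dist u x + 1 = j + 1)).card * |w j|) = 0 := by
        rw [← hr]
        simp only [hW, pow_succ]
        ring
      have h1 := (mul_eq_zero.1 hfac).resolve_left hpow
      have h2 : (((G.neighborFinset y).filter (fun x => G.dist u x + 1 = j + 1)).card : ℝ) *
          |w j| = 0 := by
        refine le_antisymm ?_ (by positivity)
        have : 0 ≤ (((G.neighborFinset y).filter (fun x => G.dist u x = j + 1 + 1)).card : ℝ) *
          |w (j + 2)| := by positivity
        linarith
      rw [mul_eq_zero, Nat.cast_eq_zero, abs_eq_zero] at h2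
      exact h0 (h.zero_eq_zero hG hreg hi (h2.resolve_left hc.ne') hwi)
  obtain ⟨a, ha⟩ := hG.exists_dist_eq hi
  obtain ⟨b, hb, hdb⟩ := hG.exists_adj_dist ha
  have h1 := hterm b a (by simpa using hb.symm)
  simp only [hg, hx, ha, hdb, hsucc] at h1
  refine lt_of_le_of_ne ?_ (mul_ne_zero (hne i (by omega)) (hne _ hi))
  rw [← h1]
  exact neg_nonpos.2 (abs_nonneg _)

theorem radial_apply_zero_ne_zero [Nonempty V] {j : ℕ} (hj : j < G.distinctEigenvalues.card)
    {w : ℕ → ℝ} (h : ∀ u v, G.idempotent j u v = w (G.dist u v)) : w 0 ≠ 0 := by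
  intro h0
  have h1 := trace_idempotent (G := G) j
  have h2 := avgMult_pos hj
  rw [avgMult, ← h1, trace] at h2
  simp [h, h0] at h2

theorem Connected.isDistanceRegular_of_isRadial_idempotent [Nontrivial V] (hG : G.Connected)
    {k : ℕ} (hreg : G.IsRegularOfDegree k) (hcard : 1 < G.distinctEigenvalues.card)
    (h1 : G.IsRadial (G.idempotent 1)) (hd : G.IsRadial (G.idempotent G.spectralDiam)) :
    G.IsDistanceRegular := by
  obtain ⟨w, hw⟩ := h1
  obtain ⟨z, hz⟩ := hd
  have hw0 := radial_apply_zero_ne_zero hcard hw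
  have hz0 := radial_apply_zero_ne_zero (by rw [spectralDiam]; omega) hz
  have hwe := isRadialEigen_of_idempotent hw
  have hze := isRadialEigen_of_idempotent hz
  have hlt : G.eigenval 1 < k := hreg.eigenval_zero ▸ eigenval_lt one_pos hcard
  obtain ⟨u₀, v₀, hdiam⟩ := G.exists_dist_eq_diam
  have hdpos : 0 < G.diam := Nat.pos_of_ne_zero (connected_iff_diam_ne_zero.1 hG)
  have hzneg : ∀ i, i + 1 ≤ G.diam → z i * z (i + 1) < 0 := fun i hi =>
    (hze u₀).mul_succ_neg hG hreg hz0 (hdiam.symm ▸ hi)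
  have key : ∀ u v u' v' : V, G.dist u v = G.dist u' v' →
      (((G.neighborFinset v).filter (fun x => G.dist u x = G.dist u v + 1)).card : ℝ) =
        ((G.neighborFinset v').filter (fun x => G.dist u' x = G.dist u' v' + 1)).card ∧
      (((G.neighborFinset v).filter (fun x => G.dist u x + 1 = G.dist u v)).card : ℝ) =
        ((G.neighborFinset v').filter (fun x => G.dist u' x + 1 = G.dist u' v')).card := by
    intro u v u' v' huv
    obtain ⟨i, hi⟩ : ∃ i, G.dist u v = i := ⟨_, rfl⟩
    have hi' : G.dist u' v' = i := huv ▸ hi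
    have ew := (hwe u).recurrence hG hreg hi
    have ew' := (hwe u').recurrence hG hreg hi'
    have ez := (hze u).recurrence hG hreg hi
    have ez' := (hze u').recurrence hG hreg hi'
    rw [hi, hi']
    have hile : i ≤ G.diam := hi ▸ hG.dist_le_diam' u v
    have hbD : i = G.diam → ∀ a b : V,
        (((G.neighborFinset b).filter (fun x => G.dist a x = i + 1)).card : ℝ) = 0 := by
      intro hD a b
      rw [Nat.cast_eq_zero, card_eq_zero, filter_eq_empty_iff]
      intro y _ hy
      have := hG.dist_le_diam' a y
      omega
    have hc0 : i = 0 → ∀ a b : V,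
        (((G.neighborFinset b).filter (fun x => G.dist a x + 1 = i)).card : ℝ) = 0 := by
      rintro rfl a b
      simp
    set b := (((G.neighborFinset v).filter (fun x => G.dist u x = i + 1)).card : ℝ)
    set b' := (((G.neighborFinset v').filter (fun x => G.dist u' x = i + 1)).card : ℝ)
    set c := (((G.neighborFinset v).filter (fun x => G.dist u x + 1 = i)).card : ℝ)
    set c' := (((G.neighborFinset v').filter (fun x => G.dist u' x + 1 = i)).card : ℝ)
    -- At distance zero, or at the diameter, one of the two counts is zero and the equation from
    -- `E_d` alone determines the other.
    rcases Nat.eq_zero_or_pos i with h0 | hpos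
    · have hc : c = 0 := hc0 h0 u v
      have hc' : c' = 0 := hc0 h0 u' v'
      refine ⟨?_, by rw [hc, hc']⟩
      have hn := hzneg i (by omega)
      have hne : z (i + 1) - z i ≠ 0 := fun h =>
        (mul_self_nonneg (z i)).not_gt (by rwa [sub_eq_zero.1 h] at hn)
      rw [hc] at ez
      rw [hc'] at ez'
      exact mul_right_cancel₀ hne (by linarith)
    · obtain ⟨m, rfl⟩ : ∃ m, i = m + 1 := ⟨i - 1, by omega⟩
      rw [Nat.add_sub_cancel] at ew ew' ez ez'
      have hn := hzneg m hile
      rcases hile.eq_or_lt with hD | hD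
      · have hb : b = 0 := hbD hD u v
        have hb' : b' = 0 := hbD hD u' v'
        refine ⟨by rw [hb, hb'], ?_⟩
        have hne : z m - z (m + 1) ≠ 0 := fun h =>
          (mul_self_nonneg (z (m + 1))).not_gt (by rwa [sub_eq_zero.1 h] at hn)
        rw [hb] at ez
        rw [hb'] at ez'
        exact mul_right_cancel₀ hne (by linarith)
      · have hn' := hzneg (m + 1) hD
        have hmono := (hwe u₀).mul_sub_nonneg hG hreg hlt (v := v₀) (i := m) (by omega)
        obtain ⟨p, hp⟩ : ∃ p, p = w m - w (m + 1) := ⟨_, rfl⟩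
        obtain ⟨q, hq⟩ : ∃ q, q = w (m + 1) - w (m + 2) := ⟨_, rfl⟩
        obtain ⟨r, hr⟩ : ∃ r, r = z m - z (m + 1) := ⟨_, rfl⟩
        obtain ⟨s, hs⟩ : ∃ s, s = z (m + 2) - z (m + 1) := ⟨_, rfl⟩
        rw [← hp, ← hq] at hmono
        -- If `w` were constant across three consecutive distances, the recurrence would give `k =
        -- λ_1` or a zero value, hence two consecutive zeros.
        have hpq : ¬ (p = 0 ∧ q = 0) := by
          rintro ⟨hp0, hq0⟩
          have e1 : w m = w (m + 1) := by linarith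
          have e2 : w (m + 1 + 1) = w (m + 1) := by
            change w (m + 2) = _
            linarith
          rw [e1, e2] at ew
          have e3 : (k - G.eigenval 1) * w (m + 1) = 0 := by linarith
          have e4 := (mul_eq_zero.1 e3).resolve_left (by linarith)
          exact hw0 ((hwe u₀).zero_eq_zero hG hreg (v := v₀) (i := m) (by omega)
            (by rw [e1, e4]) e4)
        have hrs : 0 < r * s := by
          have f1 : r * z (m + 1) < 0 := by rw [hr]; nlinarith [sq_nonneg (z (m + 1))]
          have f2 : s * z (m + 1) < 0 := by
            rw [hs]
            change z (m + 1) * z (m + 2) < 0 at hn'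
            nlinarith [sq_nonneg (z (m + 1))]
          have f3 := mul_pos_of_neg_of_neg f1 f2
          have f4 : 0 < r * s * z (m + 1) ^ 2 := by linarith
          exact pos_of_mul_pos_left f4 (sq_nonneg _)
        -- The products `s * p` and `q * r` cannot have opposite signs, since `p * q ≥ 0` and `r * s
        -- > 0`, so their sum vanishes only if both do.
        have hdet : s * p + q * r ≠ 0 := by
          intro hdet
          have f1 : (s * p) ^ 2 + (q * r) ^ 2 + 2 * ((p * q) * (r * s)) = 0 := by
            linear_combination (s * p + q * r) * hdet
          have f2 := mul_nonneg hmono hrs.le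
          have f3 : s * p = 0 := by nlinarith [sq_nonneg (s * p), sq_nonneg (q * r)]
          have f4 : q * r = 0 := by nlinarith [sq_nonneg (s * p), sq_nonneg (q * r)]
          have hs0 : s ≠ 0 := by
            rintro rfl
            simp at hrs
          have hr0 : r ≠ 0 := by
            rintro rfl
            simp at hrs
          exact hpq ⟨(mul_eq_zero.1 f3).resolve_left hs0, (mul_eq_zero.1 f4).resolve_right hr0⟩
        have g1 : (c - c') * p - (b - b') * q = 0 := by
          rw [hp, hq]
          linear_combination ew - ew'
        have g2 : (c - c') * r + (b - b') * s = 0 := by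
          rw [hr, hs]
          linear_combination ez - ez'
        constructor
        · refine sub_eq_zero.1 ((mul_eq_zero.1 ?_).resolve_right hdet)
          linear_combination p * g2 - r * g1
        · refine sub_eq_zero.1 ((mul_eq_zero.1 ?_).resolve_right hdet)
          linear_combination s * g1 + q * g2
  exact hG.isDistanceRegular_of_forall
    (fun u v u' v' h => by exact_mod_cast (key u v u' v' h).1)
    (fun u v u' v' h => by exact_mod_cast (key u v u' v' h).2)

end

end SimpleGraph

/-! ### Predistance polynomials and condition (c). -/

namespace SimpleGraph

section

set_option linter.unusedSectionVars false

open Finset Polynomial Matrix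

variable {V : Type*} [Fintype V] [DecidableEq V] {G : SimpleGraph V} [DecidableRel G.Adj]

theorem transpose_aeval_adjMatrix (f : ℝ[X]) :
    (aeval (G.adjMatrix ℝ) f)ᵀ = aeval (G.adjMatrix ℝ) f := by
  simp only [aeval_eq_sum_idempotent, transpose_sum, transpose_smul, transpose_idempotent]

theorem polyInner_eq_frob (f g : ℝ[X]) :
    G.polyInner f g =
      frob (aeval (G.adjMatrix ℝ) f) (aeval (G.adjMatrix ℝ) g) / Fintype.card V := by
  rw [polyInner, frob_eq_trace, transpose_aeval_adjMatrix]

theorem polyInner_comm (f g : ℝ[X]) : G.polyInner f g = G.polyInner g f := by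
  rw [polyInner_eq_frob, polyInner_eq_frob, frob_comm]

theorem polyInner_sub_left (f g h : ℝ[X]) :
    G.polyInner (f - g) h = G.polyInner f h - G.polyInner g h := by
  simp only [polyInner_eq_frob, map_sub, LinearMap.sub_apply, sub_div]

theorem polyInner_add_right (f g h : ℝ[X]) :
    G.polyInner f (g + h) = G.polyInner f g + G.polyInner f h := by
  simp only [polyInner_eq_frob, map_add, add_div]

theorem polyInner_C_mul_left (a : ℝ) (f g : ℝ[X]) :
    G.polyInner (C a * f) g = a * G.polyInner f g := by
  simp only [polyInner_eq_frob, map_mul, aeval_C, ← Algebra.smul_def, map_smul,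
    LinearMap.smul_apply, smul_eq_mul, mul_div_assoc]

theorem polyInner_C_mul_right (a : ℝ) (f g : ℝ[X]) :
    G.polyInner f (C a * g) = a * G.polyInner f g := by
  rw [polyInner_comm, polyInner_C_mul_left, polyInner_comm]

theorem polyInner_sum_left {ι : Type*} (s : Finset ι) (f : ι → ℝ[X]) (g : ℝ[X]) :
    G.polyInner (∑ i ∈ s, f i) g = ∑ i ∈ s, G.polyInner (f i) g := by
  simp only [polyInner_eq_frob, map_sum, LinearMap.sum_apply, sum_div]

theorem monic_monicOrthPoly_and_natDegree (i : ℕ) :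
    (G.monicOrthPoly i).Monic ∧ (G.monicOrthPoly i).natDegree = i := by
  induction i using Nat.strong_induction_on with
  | _ i ih =>
    have hlt : (-∑ j : Fin i, C (G.polyInner (X ^ i) (G.monicOrthPoly j) /
        G.polyInner (G.monicOrthPoly j) (G.monicOrthPoly j)) * G.monicOrthPoly j).degree < i := by
      rw [degree_neg, degree_lt_iff_coeff_zero]
      intro m hm
      rw [finsetSum_coeff]
      refine sum_eq_zero fun j _ => ?_
      rw [coeff_C_mul, coeff_eq_zero_of_natDegree_lt (by rw [(ih j j.2).2]; omega), mul_zero]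
    rw [monicOrthPoly, sub_eq_add_neg]
    have hmonic := monic_X_pow_add hlt
    refine ⟨hmonic, natDegree_eq_of_degree_eq_some ?_⟩
    rw [degree_add_eq_left_of_degree_lt (by rwa [degree_X_pow]), degree_X_pow]

theorem Connected.polyInner_monicOrthPoly_self_ne_zero (hG : G.Connected) {i : ℕ}
    (hi : i ≤ G.diam) : G.polyInner (G.monicOrthPoly i) (G.monicOrthPoly i) ≠ 0 := by
  have hne := hG.nonempty
  have hn : (Fintype.card V : ℝ) ≠ 0 := by exact_mod_cast Fintype.card_ne_zero
  obtain ⟨hm, hd⟩ := monic_monicOrthPoly_and_natDegree (G := G) i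
  rw [polyInner_eq_frob]
  refine div_ne_zero (fun h => ?_) hn
  have hlt := hG.degree_lt_of_frob_eq_zero (f := G.monicOrthPoly i) (by omega) (i := 0)
    fun l _ _ => by rw [frob_self_eq_zero.1 h, map_zero, LinearMap.zero_apply]
  exact hm.ne_zero (degree_eq_bot.1 (Nat.WithBot.lt_zero_iff.1 hlt))

theorem Connected.polyInner_monicOrthPoly_of_ne (hG : G.Connected) {i j : ℕ} (hi : i ≤ G.diam)
    (hj : j ≤ G.diam) (hij : i ≠ j) :
    G.polyInner (G.monicOrthPoly i) (G.monicOrthPoly j) = 0 := by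
  have key : ∀ i ≤ G.diam, ∀ j < i, G.polyInner (G.monicOrthPoly i) (G.monicOrthPoly j) = 0 := by
    intro i
    induction i using Nat.strong_induction_on with
    | _ i ih =>
      intro hi j hj
      rw [monicOrthPoly, polyInner_sub_left, polyInner_sum_left,
        sum_eq_single_of_mem (⟨j, hj⟩ : Fin i) (mem_univ _)]
      · rw [polyInner_C_mul_left,
          div_mul_cancel₀ _ (hG.polyInner_monicOrthPoly_self_ne_zero (by omega)), sub_self]
      · rintro ⟨l, hl⟩ - hlj
        rw [polyInner_C_mul_left]
        rcases lt_or_gt_of_ne (show l ≠ j from fun h => hlj (by simp [h])) with h | h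
        · rw [polyInner_comm (G.monicOrthPoly l) (G.monicOrthPoly j), ih j hj (by omega) l h, mul_zero]
        · rw [ih l hl (by omega) j h, mul_zero]
  rcases lt_or_gt_of_ne hij with h | h
  · rw [polyInner_comm, key j hj i h]
  · exact key i hi j h

/-- The sum of the first predistance polynomials represents the evaluation at the largest
eigenvalue. -/
theorem Connected.polyInner_predistSum (hG : G.Connected) {m : ℕ} (hm : m ≤ G.diam) {f : ℝ[X]}
    (hf : f.natDegree ≤ m) : G.polyInner (G.predistSum m) f = f.eval (G.eigenval 0) := by
  -- The normalization of the predistance polynomials is exactly what gives this on the orthogonal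
  -- basis; the general case follows by removing leading terms.
  have hq : ∀ j ≤ m, G.polyInner (G.predistSum m) (G.monicOrthPoly j) =
      (G.monicOrthPoly j).eval (G.eigenval 0) := by
    intro j hj
    rw [predistSum, polyInner_sum_left, sum_eq_single_of_mem j (by grind)]
    · rw [predistPoly, polyInner_C_mul_left,
        div_mul_cancel₀ _ (hG.polyInner_monicOrthPoly_self_ne_zero (by omega))]
    · intro i hi hij
      rw [predistPoly, polyInner_C_mul_left,
        hG.polyInner_monicOrthPoly_of_ne (by grind) (by omega) hij, mul_zero]
  have key : ∀ n ≤ m + 1, ∀ f : ℝ[X], f.degree < n →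
      G.polyInner (G.predistSum m) f = f.eval (G.eigenval 0) := by
    intro n
    induction n with
    | zero =>
      intro _ f hf
      rw [degree_eq_bot.1 (Nat.WithBot.lt_zero_iff.1 hf)]
      simp [polyInner_eq_frob]
    | succ n ih =>
      intro hn f hf
      obtain ⟨hmon, hdeg⟩ := monic_monicOrthPoly_and_natDegree (G := G) n
      have hlt : (f - C (f.coeff n) * G.monicOrthPoly n).degree < n := by
        rw [degree_lt_iff_coeff_zero] at hf ⊢
        intro l hl
        rw [coeff_sub, coeff_C_mul]
        rcases hl.eq_or_lt with rfl | hl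
        · have : (G.monicOrthPoly n).coeff n = 1 := by
            rw [Monic, leadingCoeff, hdeg] at hmon
            exact hmon
          rw [this, mul_one, sub_self]
        · rw [hf l hl, coeff_eq_zero_of_natDegree_lt (p := G.monicOrthPoly n) (by omega), mul_zero,
            sub_zero]
      have h := ih (by omega) _ hlt
      have hsum : f = (f - C (f.coeff n) * G.monicOrthPoly n) +
          C (f.coeff n) * G.monicOrthPoly n := by ring
      rw [hsum, polyInner_add_right, h, polyInner_C_mul_right, hq n (by omega), eval_add,
        eval_C_mul]
  exact key (m + 1) le_rfl f (lt_of_le_of_lt (degree_le_of_natDegree_le hf)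
    (by exact_mod_cast Nat.lt_succ_self m))

theorem natDegree_predistSum_le (m : ℕ) : (G.predistSum m).natDegree ≤ m :=
  natDegree_sum_le_of_forall_le _ _ fun i hi => by
    refine (natDegree_C_mul_le _ _).trans ?_
    rw [(monic_monicOrthPoly_and_natDegree i).2]
    grind

theorem Connected.sum_aeval_apply (hG : G.Connected) {k : ℕ} (hreg : G.IsRegularOfDegree k)
    (f : ℝ[X]) (u : V) :
    ∑ v, aeval (G.adjMatrix ℝ) f u v = f.eval (G.eigenval 0) := by
  have hne := hG.nonempty
  have hn : (Fintype.card V : ℝ) ≠ 0 := by exact_mod_cast Fintype.card_ne_zero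
  have h := congr_fun₂ (aeval_mul_idempotent (G := G) f 0) u u
  rw [mul_apply, Matrix.smul_apply] at h
  simp only [hG.idempotent_zero_apply hreg, smul_eq_mul] at h
  rw [← sum_mul] at h
  exact mul_right_cancel₀ (one_div_ne_zero hn) h

theorem nbhdCard_pos (i : ℕ) (u : V) : 0 < G.nbhdCard i u :=
  card_pos.2 ⟨u, by simp⟩

theorem sum_ite_dist_le (i : ℕ) (u : V) :
    ∑ v, (if G.dist u v ≤ i then (1 : ℝ) else 0) = G.nbhdCard i u := by
  simp [nbhdCard]

/-- Here `A_0 + ⋯ + A_m = f(A)` with `deg f ≤ m`. For `g = s_m - f`, the matrix `g(A)` is supported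
within distance `m`, so `⟨f, g⟩ = g(λ_0) = ⟨s_m, g⟩`. Hence `⟨g, g⟩ = 0`, and the row sums of
`s_m(A)` are ball sizes. -/
theorem IsDistanceRegular.predistSum_eval {k : ℕ} (h : G.IsDistanceRegular)
    (hreg : G.IsRegularOfDegree k) {m : ℕ} (hm : m ≤ G.diam) (u : V) :
    (G.predistSum m).eval (G.eigenval 0) = G.nbhdCard m u := by
  have hG := h.1
  have hne := hG.nonempty
  have hn : (Fintype.card V : ℝ) ≠ 0 := by exact_mod_cast Fintype.card_ne_zero
  choose F hF hFA using h.exists_distMatrix_eq_aeval hreg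
  set f : ℝ[X] := ∑ i ∈ range (m + 1), F i with hf
  have hfd : f.natDegree ≤ m := natDegree_sum_le_of_forall_le _ _ fun i hi =>
    (hF i).trans (by grind)
  have hfA : ∀ u v, aeval (G.adjMatrix ℝ) f u v = if G.dist u v ≤ m then 1 else 0 := by
    intro u v
    simp [hf, map_sum, hFA, Matrix.sum_apply, distMatrix_apply]
  set g := G.predistSum m - f with hg
  have hgd : g.natDegree ≤ m := (natDegree_sub_le _ _).trans
    (max_le (natDegree_predistSum_le m) hfd)
  have h1 : G.polyInner f g = g.eval (G.eigenval 0) := by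
    rw [polyInner_eq_frob, frob_apply]
    have : ∀ u v, aeval (G.adjMatrix ℝ) f u v * aeval (G.adjMatrix ℝ) g u v =
        aeval (G.adjMatrix ℝ) g u v := by
      intro u v
      rw [hfA]
      split_ifs with huv
      · rw [one_mul]
      · rw [zero_mul, aeval_adjMatrix_apply (by omega), coeff_eq_zero_of_natDegree_lt (by omega),
          zero_mul]
    simp only [this, hG.sum_aeval_apply hreg, sum_const, card_univ, nsmul_eq_mul]
    rw [mul_div_cancel_left₀ _ hn]
  have h2 : G.polyInner g g = 0 := by
    conv_lhs => rw [hg]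
    rw [polyInner_sub_left, ← hg, h1, hG.polyInner_predistSum hm hgd, sub_self]
  rw [polyInner_eq_frob, div_eq_zero_iff, or_iff_left hn, frob_self_eq_zero, hg, map_sub,
    sub_eq_zero] at h2
  rw [← hG.sum_aeval_apply hreg _ u, h2]
  simp only [hfA]
  exact sum_ite_dist_le m u

theorem Connected.distMatrix_mem_adjoin_of_predistSum_eval (hG : G.Connected) {k : ℕ}
    (hreg : G.IsRegularOfDegree k) {m : ℕ} (hm : m + 1 = G.diam)
    (h : (G.predistSum m).eval (G.eigenval 0) =
      (Fintype.card V : ℝ) / ∑ u : V, ((G.nbhdCard m u : ℝ))⁻¹) :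
    G.distMatrix G.diam ∈ Algebra.adjoin ℝ {G.adjMatrix ℝ} := by
  have hne := hG.nonempty
  have hn : (0 : ℝ) < Fintype.card V := by exact_mod_cast Fintype.card_pos
  have hN : ∀ u, (0 : ℝ) < G.nbhdCard m u := fun u => by exact_mod_cast nbhdCard_pos m u
  set ρ := (G.predistSum m).eval (G.eigenval 0) with hρ
  set M := aeval (G.adjMatrix ℝ) (G.predistSum m) with hM
  have hS : 0 < ∑ u : V, ((G.nbhdCard m u : ℝ))⁻¹ :=
    sum_pos (fun u _ => inv_pos.2 (hN u)) univ_nonempty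
  have hρpos : 0 < ρ := by
    rw [h]
    positivity
  have hρS : ρ * ∑ u : V, ((G.nbhdCard m u : ℝ))⁻¹ = Fintype.card V := by
    rw [h, div_mul_cancel₀ _ hS.ne']
  have hM0 : ∀ u v, m < G.dist u v → M u v = 0 := fun u v huv => by
    have := natDegree_predistSum_le (G := G) m
    rw [hM, aeval_adjMatrix_apply (by omega), coeff_eq_zero_of_natDegree_lt (by omega), zero_mul]
  have hrow : ∀ u, ∑ v, M u v = ρ := fun u => hG.sum_aeval_apply hreg _ u
  have hfrob : ∑ u, ∑ v, M u v * M u v = Fintype.card V * ρ := by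
    have := hG.polyInner_predistSum (m := m) (by omega) (natDegree_predistSum_le (G := G) m)
    rw [polyInner_eq_frob, div_eq_iff hn.ne', mul_comm, ← hρ] at this
    exact this
  -- The Cauchy-Schwarz defect of row `u`, written as its squared distance from the constant row
  -- with sum `ρ` on the ball. The hypothesis says that these defects sum to zero.
  have hrowsq : ∀ u, ∑ v, (M u v - if G.dist u v ≤ m then ρ / G.nbhdCard m u else 0) ^ 2 =
      ∑ v, M u v * M u v - ρ ^ 2 * (G.nbhdCard m u : ℝ)⁻¹ := by
    intro u
    have hNu := (hN u).ne'
    have h1 : ∀ v, (M u v - if G.dist u v ≤ m then ρ / G.nbhdCard m u else 0) ^ 2 =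
        M u v * M u v - 2 * (ρ / G.nbhdCard m u) * M u v +
          (ρ / G.nbhdCard m u) ^ 2 * if G.dist u v ≤ m then 1 else 0 := by
      intro v
      split_ifs with huv
      · ring
      · rw [hM0 u v (by omega)]
        ring
    simp only [h1, sum_add_distrib, sum_sub_distrib, ← mul_sum, hrow, sum_ite_dist_le]
    field_simp
    ring
  have htot : ∑ u, ∑ v, (M u v - if G.dist u v ≤ m then ρ / G.nbhdCard m u else 0) ^ 2 = 0 := by
    simp only [hrowsq, sum_sub_distrib, ← mul_sum, hfrob]
    rw [sq, mul_assoc, hρS]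
    ring
  have hMe : ∀ u v, M u v = if G.dist u v ≤ m then ρ / G.nbhdCard m u else 0 := by
    intro u v
    have h1 := (sum_eq_zero_iff_of_nonneg fun u _ => sum_nonneg fun v _ => sq_nonneg _).1 htot u
      (mem_univ u)
    have h2 := (sum_eq_zero_iff_of_nonneg fun v _ => sq_nonneg _).1 h1 v (mem_univ v)
    exact sub_eq_zero.1 (pow_eq_zero_iff two_ne_zero |>.1 h2)
  -- For `m > 0` adjacent vertices lie in each other's balls, so symmetry of `M` compares the ball
  -- sizes. For `m = 0` every ball is a single vertex.
  have hadj : ∀ u v, G.Adj u v → G.nbhdCard m u = G.nbhdCard m v := by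
    intro u v huv
    rcases Nat.eq_zero_or_pos m with rfl | hpos
    · simp [nbhdCard, hG.dist_eq_zero_iff, filter_eq]
    · have h1 : M u v = M v u := by
        conv_lhs => rw [hM, ← transpose_aeval_adjMatrix]
        rfl
      rw [hMe, hMe, if_pos (by rw [dist_eq_one_iff_adj.2 huv]; omega),
        if_pos (by rw [dist_eq_one_iff_adj.2 huv.symm]; omega),
        div_eq_div_iff (hN u).ne' (hN v).ne'] at h1
      exact_mod_cast (mul_left_cancel₀ hρpos.ne' h1).symm
  have hconst : ∀ u v, G.nbhdCard m u = G.nbhdCard m v := by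
    intro u v
    obtain ⟨p⟩ := hG.preconnected u v
    induction p with
    | nil => rfl
    | cons huv _ ih => exact (hadj _ _ huv).trans ih
  obtain ⟨u₀⟩ := hne
  have hA : G.distMatrix G.diam = Matrix.of (fun _ _ => 1) - (G.nbhdCard m u₀ / ρ : ℝ) • M := by
    ext u v
    have := hG.dist_le_diam' u v
    have hNu := (hN u₀).ne'
    rw [Matrix.sub_apply, Matrix.smul_apply, distMatrix_apply, hMe, hconst u u₀, of_apply,
      smul_eq_mul]
    rcases this.eq_or_lt with hd | hd
    · rw [if_pos hd, if_neg (by omega)]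
      ring
    · rw [if_neg hd.ne, if_pos (by omega)]
      field_simp
      ring
  rw [hA]
  exact sub_mem (hG.ones_mem_adjoin hreg)
    (Subalgebra.smul_mem _ (aeval_mem_adjoin_singleton _ _) _)

/-! ### Conditions (a) and (b) as equalities in Bessel's inequality. -/

theorem frob_distMatrix_self [Nonempty V] (i : ℕ) :
    frob (G.distMatrix i) (G.distMatrix i) = Fintype.card V * G.avgDistDegree i := by
  rw [frob_distMatrix_right, avgDistDegree, mul_div_cancel₀ _ (by simp)]
  refine sum_congr rfl fun u _ => ?_
  rw [sum_congr rfl (g := fun _ => (1 : ℝ)) fun v hv => by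
    rw [distMatrix_apply, if_pos (by simpa using hv)]]
  simp

theorem avgCrossedMult_eq (i j : ℕ) :
    G.avgCrossedMult i j = 1 / (Fintype.card V * G.avgDistDegree i) *
      frob (G.idempotent j) (G.distMatrix i) := by
  rw [avgCrossedMult, frob_distMatrix_right]

theorem Connected.isDistanceRegular_iff_distMatrix_mem (hG : G.Connected) {k : ℕ}
    (hreg : G.IsRegularOfDegree k) (hd : G.spectralDiam = G.diam) :
    G.IsDistanceRegular ↔ G.distMatrix G.diam ∈ Algebra.adjoin ℝ {G.adjMatrix ℝ} := by
  constructor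
  · intro h
    obtain ⟨f, -, hf⟩ := h.exists_distMatrix_eq_aeval hreg G.diam
    exact hf ▸ aeval_mem_adjoin_singleton _ _
  · refine hG.isDistanceRegular_of_distMatrix_mem (fun M hM => ?_) (hG.ones_mem_adjoin hreg)
    exact hd ▸ exists_natDegree_le_of_mem_adjoin hM

theorem mem_adjoin_iff_eq_frobProj [Nonempty V] (M : Matrix V V ℝ) :
    M ∈ Algebra.adjoin ℝ {G.adjMatrix ℝ} ↔
      M = frobProj (range G.distinctEigenvalues.card) G.idempotent M := by
  constructor
  · intro h
    obtain ⟨f, -, hf⟩ := exists_natDegree_le_of_mem_adjoin h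
    rw [aeval_eq_sum_idempotent] at hf
    refine eq_frobProj_of_eq_sum (fun a ha b hb => frob_idempotent_of_ne (by simpa using ha)
      (by simpa using hb)) (fun a ha => ?_) hf.symm
    rw [frob_idempotent_self]
    exact mul_ne_zero (by simp) (avgMult_pos (by simpa using ha)).ne'
  · intro h
    rw [h]
    exact sum_mem fun j hj =>
      Subalgebra.smul_mem _ (idempotent_mem_adjoin (by simpa using hj)) _

theorem Connected.avgDistDegree_pos (hG : G.Connected) {i : ℕ} (hi : i ≤ G.diam) :
    0 < G.avgDistDegree i := by
  have hne := hG.nonempty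
  have h := hG.frob_distMatrix_self_pos hi
  rw [frob_distMatrix_self] at h
  exact pos_of_mul_pos_right h (by positivity)

/-- Bessel equality for `A_i` against the `E_j`, whose squared norms are their multiplicities. -/
theorem Connected.distMatrix_mem_iff (hG : G.Connected) {i : ℕ} (hi : i ≤ G.diam) :
    G.distMatrix i ∈ Algebra.adjoin ℝ {G.adjMatrix ℝ} ↔
      1 / G.avgDistDegree i =
        ∑ j ∈ range G.distinctEigenvalues.card, G.avgCrossedMult i j ^ 2 / G.avgMult j := by
  have hne := hG.nonempty
  have hn : (Fintype.card V : ℝ) ≠ 0 := by simp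
  have hδ := (hG.avgDistDegree_pos hi).ne'
  rw [mem_adjoin_iff_eq_frobProj, ← sum_sq_div_eq_iff (fun a ha b hb => frob_idempotent_of_ne
      (by simpa using ha) (by simpa using hb)) (fun a ha => by
        rw [frob_idempotent_self]
        exact mul_ne_zero hn (avgMult_pos (by simpa using ha)).ne'), frob_distMatrix_self]
  have hsum : ∑ j ∈ range G.distinctEigenvalues.card, G.avgCrossedMult i j ^ 2 / G.avgMult j =
      1 / (Fintype.card V * G.avgDistDegree i ^ 2) *
        ∑ j ∈ range G.distinctEigenvalues.card, frob (G.distMatrix i) (G.idempotent j) ^ 2 /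
          frob (G.idempotent j) (G.idempotent j) := by
    rw [mul_sum]
    refine sum_congr rfl fun j hj => ?_
    have := (avgMult_pos (G := G) (by simpa using hj)).ne'
    rw [avgCrossedMult_eq, frob_idempotent_self, frob_comm]
    field_simp
  rw [hsum]
  constructor
  · intro h
    rw [← h]
    field_simp
  · intro h
    field_simp at h ⊢
    linarith

/-- The dual situation: Bessel equality for `E_j` against the distance matrices. -/
theorem Connected.isRadial_idempotent_iff (hG : G.Connected) (j : ℕ) :
    G.IsRadial (G.idempotent j) ↔
      G.avgMult j = ∑ i ∈ range (G.diam + 1), G.avgDistDegree i * G.avgCrossedMult i j ^ 2 := by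
  have hne := hG.nonempty
  have hn : (Fintype.card V : ℝ) ≠ 0 := by simp
  rw [isRadial_iff_eq_frobProj hG, ← sum_sq_div_eq_iff (fun a _ b _ => frob_distMatrix_of_ne)
    (fun a ha => (hG.frob_distMatrix_self_pos (by grind)).ne'), frob_idempotent_self]
  have hsum : ∑ i ∈ range (G.diam + 1), G.avgDistDegree i * G.avgCrossedMult i j ^ 2 =
      1 / Fintype.card V * ∑ i ∈ range (G.diam + 1),
        frob (G.idempotent j) (G.distMatrix i) ^ 2 /
          frob (G.distMatrix i) (G.distMatrix i) := by
    rw [mul_sum]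
    refine sum_congr rfl fun i hi => ?_
    have := (hG.avgDistDegree_pos (i := i) (by grind)).ne'
    rw [avgCrossedMult_eq, frob_distMatrix_self]
    field_simp
  rw [hsum]
  constructor
  · intro h
    rw [← h]
    field_simp
  · intro h
    rw [h]
    field_simp

end

end SimpleGraph

/-! ### The three equivalences. -/

theorem mainTheorem1 {V : Type*} [Fintype V] [DecidableEq V] [Nontrivial V]
    (G : SimpleGraph V) [DecidableRel G.Adj] (hconn : G.Connected)
    (k : ℕ) (hreg : G.IsRegularOfDegree k) (d : ℕ) (hd : G.spectralDiam = d)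
    (hD : G.diam = d) :
    (G.IsDistanceRegular ↔
      1 / G.avgDistDegree d =
        ∑ j ∈ Finset.range (d + 1), G.avgCrossedMult d j ^ 2 / G.avgMult j) ∧
    (G.IsDistanceRegular ↔
      ∀ j : ℕ, (j = 1 ∨ j = d) →
        G.avgMult j =
          ∑ i ∈ Finset.range (G.diam + 1), G.avgDistDegree i * G.avgCrossedMult i j ^ 2) ∧
    (G.IsDistanceRegular ↔
      (G.predistSum (d - 1)).eval (G.eigenval 0) =
        (Fintype.card V : ℝ) / ∑ u : V, ((G.nbhdCard (d - 1) u : ℝ))⁻¹) := by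
  subst hD
  have hpos : 0 < G.diam := Nat.pos_of_ne_zero (SimpleGraph.connected_iff_diam_ne_zero.1 hconn)
  have hcard : G.distinctEigenvalues.card = G.diam + 1 := by
    rw [SimpleGraph.spectralDiam] at hd
    omega
  have hiff := hconn.isDistanceRegular_iff_distMatrix_mem hreg hd
  refine ⟨?_, ⟨fun h j hj => ?_, fun h => ?_⟩, ⟨fun h => ?_, fun h => ?_⟩⟩
  · rw [hiff, hconn.distMatrix_mem_iff le_rfl, hcard]
  · rw [← hconn.isRadial_idempotent_iff, ← SimpleGraph.aeval_eigenBasis (by omega)]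
    exact h.isRadial_aeval hreg _
  · refine hconn.isDistanceRegular_of_isRadial_idempotent hreg (by omega) ?_ ?_
    · exact (hconn.isRadial_idempotent_iff 1).2 (h 1 (Or.inl rfl))
    · exact (hconn.isRadial_idempotent_iff _).2 (h _ (Or.inr hd))
  -- All balls have size `s_{d-1}(λ_0)`, so their harmonic mean is this number.
  · have hN := h.predistSum_eval hreg (Nat.sub_le G.diam 1)
    simp only [← hN, Finset.sum_const, Finset.card_univ, nsmul_eq_mul]
    rw [div_mul_cancel_left₀ (by simp), inv_inv]
  · exact hiff.2 (hconn.distMatrix_mem_adjoin_of_predistSum_eval hreg (by omega) h)
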